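/- Let $1<\alpha<\beta<\infty$ and $\Omega=(-\infty,0)\cup(1,\alpha)\cup(\beta,\infty)$, and let $L^2(\Omega)$ carry the inner product $\langle f,g\rangle=\int_\Omega \overline{f}\,g\,dx$. Write $e(x)=e^{2\pi i x}$. For $0<w\le 1$ and $\theta,\phi,\psi\in\mathbb{R}$ let $$B=\begin{pmatrix} w\,e(\phi) & -\sqrt{1-w^2}\,e(\theta-\psi)\\ \sqrt{1-w^2}\,e(\psi) & w\,e(\theta-\phi)\end{pmatrix}\in U(2).$$ Let $P_B$ be the operator $P_Bf=\frac{1}{2\pi i}f'$ in $L^2(\Omega)$ whose domain consists of all (locally) absolutely continuous $f\in L^2(\Omega)$ with $f'\in L^2(\Omega)$ and $$B\begin{pmatrix} f(1)\\ f(\beta)\end{pmatrix}=\begin{pmatrix} f(0)\\ f(\alpha)\end{pmatrix},$$ where the boundary values are limits from inside $\Omega$. Then $P_B$ generates a unique strongly continuous one-parameter group of unitary operators $U_B(t)=e^{-2\pi i tP_B}$ on $L^2(\Omega)$ (that is, the infinitesimal generator of $U_B$ is exactly $-2\pi i P_B$), and for all $f,g\in L^2(\Omega)$: $$(1)\quad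 \lim_{t\to\infty}\langle f,U_B(t)g\rangle=0,\qquad (2)\quad \lim_{T\to\infty}\frac{1}{2T}\int_{-T}^{T}\bigl|\langle f,U_B(t)g\rangle\bigr|^2\,dt=0.$$ -/

import Mathlib

open MeasureTheory Filter Topology Set
open scoped Matrix

noncomputable section

/-- The exterior domain `Ω = (-∞, 0) ∪ (1, α) ∪ (β, ∞)`. -/
def exteriorDomain (α β : ℝ) : Set ℝ := Iio 0 ∪ Ioo 1 α ∪ Ioi β

theorem isOpen_exteriorDomain (α β : ℝ) : IsOpen (exteriorDomain α β) :=
  (isOpen_Iio.union isOpen_Ioo).union isOpen_Ioi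

/-- The complex Hilbert space `L²(Ω)`, with respect to Lebesgue measure on `Ω`. -/
abbrev L2Exterior (α β : ℝ) : Type := Lp ℂ 2 (volume.restrict (exteriorDomain α β))

/-- `e(x) = exp(2πix)`. -/
def unitExp (x : ℝ) : ℂ := Complex.exp (2 * Real.pi * Complex.I * x)

/-- The parametrization of the unitary `2 × 2` matrices by `0 ≤ w ≤ 1` and real `θ`, `φ`, `ψ`. -/
def boundaryMatrix (w θ φ ψ : ℝ) : Matrix (Fin 2) (Fin 2) ℂ :=
  !![w * unitExp φ, -(Real.sqrt (1 - w ^ 2) * unitExp (θ - ψ));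
    Real.sqrt (1 - w ^ 2) * unitExp ψ, w * unitExp (θ - φ)]

/-- `F` is a (locally) absolutely continuous representative of `f ∈ L²(Ω)` whose derivative
satisfies `(1 / 2πi) F' = h` almost everywhere on `Ω`, where `h ∈ L²(Ω)`. -/
structure IsMomentumRep (α β : ℝ) (f h : L2Exterior α β) (F : ℝ → ℂ) : Prop where
  ae_eq : F =ᵐ[volume.restrict (exteriorDomain α β)] f
  absCont : ∀ a b : ℝ, uIcc a b ⊆ exteriorDomain α β → AbsolutelyContinuousOnInterval F a b
  ae_deriv : ∀ᵐ x ∂(volume.restrict (exteriorDomain α β)),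
    HasDerivAt F (2 * Real.pi * Complex.I * h x) x

/-- The boundary values of `F`, taken as limits from inside `Ω`, are
`ρ₁ = (F(1), F(β))` at the left end points and `ρ₂ = (F(0), F(α))` at the right end points of the
components of `Ω`. -/
structure HasBoundaryValues (α β : ℝ) (F : ℝ → ℂ) (ρ₁ ρ₂ : Fin 2 → ℂ) : Prop where
  at_one : Tendsto F (𝓝[>] 1) (𝓝 (ρ₁ 0))
  at_beta : Tendsto F (𝓝[>] β) (𝓝 (ρ₁ 1))
  at_zero : Tendsto F (𝓝[<] 0) (𝓝 (ρ₂ 0))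
  at_alpha : Tendsto F (𝓝[<] α) (𝓝 (ρ₂ 1))

/-- The graph of `P_B`: all pairs `(f, (1 / 2πi) f')` with `f` absolutely continuous on `Ω`,
`f, f' ∈ L²(Ω)` and `B ρ₁(f) = ρ₂(f)`. -/
def momentumGraph (α β : ℝ) (B : Matrix (Fin 2) (Fin 2) ℂ) :
    Submodule ℂ (L2Exterior α β × L2Exterior α β) where
  carrier := {p | ∃ F : ℝ → ℂ, IsMomentumRep α β p.1 p.2 F ∧
    ∃ ρ₁ ρ₂ : Fin 2 → ℂ, HasBoundaryValues α β F ρ₁ ρ₂ ∧ B *ᵥ ρ₁ = ρ₂}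
  zero_mem' := by
    refine ⟨0, ⟨?_, ?_, ?_⟩, 0, 0, ⟨?_, ?_, ?_, ?_⟩, ?_⟩
    · exact (Lp.coeFn_zero _ _ _).symm
    · intro a b _
      simpa using! AbsolutelyContinuousOnInterval.const_smul (0 : ℂ)
        (show AbsolutelyContinuousOnInterval (fun _ : ℝ => (0 : ℂ)) a b by
          simp [AbsolutelyContinuousOnInterval, tendsto_const_nhds])
    · filter_upwards [Lp.coeFn_zero ℂ 2 (volume.restrict (exteriorDomain α β))] with x hx
      have h0 : ((0 : L2Exterior α β × L2Exterior α β).2 : ℝ → ℂ) x = 0 := hx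
      rw [h0, mul_zero]
      exact hasDerivAt_const x 0
    all_goals first | exact tendsto_const_nhds | simp
  add_mem' := by
    rintro ⟨f, h⟩ ⟨f', h'⟩ ⟨F, hF, ρ₁, ρ₂, hb, hB⟩ ⟨F', hF', ρ₁', ρ₂', hb', hB'⟩
    refine ⟨F + F', ⟨?_, ?_, ?_⟩, ρ₁ + ρ₁', ρ₂ + ρ₂', ⟨?_, ?_, ?_, ?_⟩, ?_⟩
    · exact (hF.ae_eq.add hF'.ae_eq).trans (Lp.coeFn_add f f').symm
    · exact fun a b hab => (hF.absCont a b hab).add (hF'.absCont a b hab)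
    · filter_upwards [hF.ae_deriv, hF'.ae_deriv, Lp.coeFn_add h h'] with x hx hx' hs
      have hs' : (((f, h) + (f', h') : L2Exterior α β × L2Exterior α β).2 : ℝ → ℂ) x
          = h x + h' x := hs
      rw [hs', mul_add]
      exact hx.add hx'
    · exact hb.at_one.add hb'.at_one
    · exact hb.at_beta.add hb'.at_beta
    · exact hb.at_zero.add hb'.at_zero
    · exact hb.at_alpha.add hb'.at_alpha
    · rw [Matrix.mulVec_add, hB, hB']
  smul_mem' := by
    rintro c ⟨f, h⟩ ⟨F, hF, ρ₁, ρ₂, hb, hB⟩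
    refine ⟨c • F, ⟨?_, ?_, ?_⟩, c • ρ₁, c • ρ₂, ⟨?_, ?_, ?_, ?_⟩, ?_⟩
    · exact (hF.ae_eq.const_smul c).trans (Lp.coeFn_smul c f).symm
    · exact fun a b hab => (hF.absCont a b hab).const_smul c
    · filter_upwards [hF.ae_deriv, Lp.coeFn_smul c h] with x hx hs
      have hs' : ((c • ((f, h) : L2Exterior α β × L2Exterior α β)).2 : ℝ → ℂ) x
          = c * h x := hs
      rw [hs', mul_left_comm]
      exact hx.const_smul c
    · exact hb.at_one.const_smul c
    · exact hb.at_beta.const_smul c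
    · exact hb.at_zero.const_smul c
    · exact hb.at_alpha.const_smul c
    · rw [Matrix.mulVec_smul, hB]

/-- The momentum operator `P_B`, i.e. `f ↦ (1 / 2πi) f'` with domain
`{f ∈ D(P) | B ρ₁(f) = ρ₂(f)}`, as a partially defined operator in `L²(Ω)`. -/
def momentumOperator (α β : ℝ) (B : Matrix (Fin 2) (Fin 2) ℂ) :
    L2Exterior α β →ₗ.[ℂ] L2Exterior α β :=
  (momentumGraph α β B).toLinearPMap

/-- The set `momentumGraph α β B` is indeed the graph of `momentumOperator α β B`. -/
theorem momentumOperator_graph (α β : ℝ) (B : Matrix (Fin 2) (Fin 2) ℂ) :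
    (momentumOperator α β B).graph = momentumGraph α β B := by
  refine Submodule.toLinearPMap_graph_eq _ ?_
  rintro ⟨f, h⟩ ⟨F, hF, -⟩ hf
  have hf0 : f = 0 := hf
  subst hf0
  change h = 0
  have hopen := isOpen_exteriorDomain α β
  have hcont : ContinuousOn F (exteriorDomain α β) := by
    intro x hx
    obtain ⟨ε, hε, hball⟩ := Metric.isOpen_iff.mp hopen x hx
    have hsub : uIcc (x - ε / 2) (x + ε / 2) ⊆ exteriorDomain α β := by
      rw [uIcc_of_le (by linarith)]
      intro y hy
      refine hball ?_
      rw [Metric.mem_ball, Real.dist_eq, abs_lt]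
      constructor <;> linarith [hy.1, hy.2]
    have h1 := (hF.absCont _ _ hsub).continuousOn
    rw [uIcc_of_le (by linarith)] at h1
    exact (h1.continuousAt (Icc_mem_nhds (by linarith) (by linarith))).continuousWithinAt
  have hzero : EqOn F 0 (exteriorDomain α β) :=
    Measure.eqOn_open_of_ae_eq (hF.ae_eq.trans (Lp.coeFn_zero _ _ _)) hopen hcont
      continuousOn_const
  rw [Lp.eq_zero_iff_ae_eq_zero]
  filter_upwards [hF.ae_deriv, ae_restrict_mem hopen.measurableSet] with x hx hxm
  have h0 : HasDerivAt F 0 x :=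
    (hasDerivAt_const x (0 : ℂ)).congr_of_eventuallyEq
      (hzero.eventuallyEq_of_mem (hopen.mem_nhds hxm))
  have h2 := hx.unique h0
  have h3 : (2 * Real.pi * Complex.I : ℂ) ≠ 0 := Complex.two_pi_I_ne_zero
  simpa [h3] using h2

/-- A strongly continuous one-parameter group of unitary operators on a Hilbert space. -/
structure UnitaryOneParameterGroup (H : Type*) [NormedAddCommGroup H] [InnerProductSpace ℂ H] where
  toFun : ℝ → H ≃ₗᵢ[ℂ] H
  map_zero : ∀ x, toFun 0 x = x
  map_add : ∀ s t x, toFun (s + t) x = toFun s (toFun t x)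
  continuous : ∀ x, Continuous fun t => toFun t x

/-- `U(t) = exp(-2πitA)`: the infinitesimal generator of `U`, i.e. the operator
`x ↦ lim_{t → 0} t⁻¹ (U(t) x - x)` defined for exactly those `x` for which the limit exists, equals
`-2πi A` (including equality of domains). -/
def UnitaryOneParameterGroup.IsGeneratedBy {H : Type*} [NormedAddCommGroup H]
    [InnerProductSpace ℂ H] (U : UnitaryOneParameterGroup H) (A : H →ₗ.[ℂ] H) : Prop :=
  ∀ x y : H, (x, y) ∈ A.graph ↔
    Tendsto (fun t : ℝ => (t : ℂ)⁻¹ • (U.toFun t x - x)) (𝓝[≠] 0)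
      (𝓝 (-(2 * Real.pi * Complex.I : ℂ) • y))

end

/-! The group moves functions to the right with unit speed; at the end points `0` and `α` a wave is
scattered by `B` into `1` and `β`. A state is encoded by the single wave `k` on the whole line that
has left, or will leave, through `β`: for `x > 0` it is the part already on `(β, ∞)`, for `x < 0`
the part still to come. In this outgoing representation the evolution is plain translation of
`L²(ℝ)`.

With `L = α - 1`, let `m` be the wave at `α` and `n` the wave at `0`. The boundary condition reads
`m(x) = B₁₀ m(x - L) + B₁₁ k(x)` and `n(x) = B₀₀ m(x - L) + B₀₁ k(x)`. Since `w > 0`, `|B₁₀| < 1`,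
so a Neumann series recovers `m`, hence `n`, from `k`. Unitarity of `B` makes `k ↦ state` isometric
(`setIntegral_norm_sq_exteriorFun`), and solving the recursion with `B*` makes it onto
(`exteriorIsometry_surjective`).

The transported group has its generator inside `-2πi P_B` (`mem_momentumGraph_of_hasGenerator`).
Equality follows because one plus a generator of a unitary group is onto, while one plus `-2πi P_B`
is injective (`eq_zero_of_mem_momentumGraph`). Skewness of generators gives uniqueness
(`ext_of_hasGenerator`). Limit (1) is the decay of translates in `L²(ℝ)`, and (2) is its Cesàro
consequence. -/

/-! ### Generators of unitary one-parameter groups. -/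

namespace UnitaryOneParameterGroup

variable {H : Type*} [NormedAddCommGroup H] [InnerProductSpace ℂ H]

/-- The pair `(x, y)` lies in the graph of the infinitesimal generator of `U`. -/
def HasGenerator (U : UnitaryOneParameterGroup H) (x y : H) : Prop :=
  HasDerivAt (fun t : ℝ => U.toFun t x) y 0

theorem hasGenerator_iff (U : UnitaryOneParameterGroup H) (x y : H) :
    U.HasGenerator x y ↔
      Tendsto (fun t : ℝ => (t : ℂ)⁻¹ • (U.toFun t x - x)) (𝓝[≠] 0) (𝓝 y) := by
  rw [HasGenerator, hasDerivAt_iff_tendsto_slope_zero]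
  refine tendsto_congr fun t => ?_
  rw [zero_add, U.map_zero, ← Complex.ofReal_inv]
  exact (Complex.coe_smul _ _).symm

theorem isGeneratedBy_iff (U : UnitaryOneParameterGroup H) (A : H →ₗ.[ℂ] H) :
    U.IsGeneratedBy A ↔ ∀ x y, (x, y) ∈ A.graph ↔
      U.HasGenerator x (-(2 * Real.pi * Complex.I : ℂ) • y) := by
  simp only [IsGeneratedBy, hasGenerator_iff]

variable {U V : UnitaryOneParameterGroup H} {x x' y y' : H}

theorem HasGenerator.sub (h : U.HasGenerator x y) (h' : U.HasGenerator x' y') :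
    U.HasGenerator (x - x') (y - y') := by
  unfold HasGenerator at *
  simpa using! HasDerivAt.sub h h'

theorem HasGenerator.hasDerivAt (h : U.HasGenerator x y) (t : ℝ) :
    HasDerivAt (fun t : ℝ => U.toFun t x) (U.toFun t y) t := by
  have h1 : HasDerivAt (fun s : ℝ => U.toFun s x) y (t - t) := by
    rw [sub_self]; exact h
  have h2 := ((U.toFun t).toContinuousLinearEquiv.toContinuousLinearMap.restrictScalars
    ℝ).hasFDerivAt.comp_hasDerivAt t (h1.comp_sub_const t t)
  refine h2.congr_of_eventuallyEq (Eventually.of_forall fun s => ?_)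
  change U.toFun s x = U.toFun t (U.toFun (s - t) x)
  rw [← U.map_add]
  congr 2; ring

theorem HasGenerator.toFun (h : U.HasGenerator x y) (t : ℝ) :
    U.HasGenerator (U.toFun t x) (U.toFun t y) := by
  have h1 : HasDerivAt (fun s : ℝ => U.toFun s x) (U.toFun t y) (0 + t) := by
    rw [zero_add]; exact h.hasDerivAt t
  have h2 := h1.comp_add_const 0 t
  refine h2.congr_of_eventuallyEq (Eventually.of_forall fun s => ?_)
  exact (U.map_add _ _ _).symm

/-- Differentiate the constant function `‖U(t)x‖²` at `0`: generators are skew. -/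
theorem HasGenerator.re_inner_eq_zero (h : U.HasGenerator x y) :
    (inner ℂ x y).re = 0 := by
  let _ : InnerProductSpace ℝ H := InnerProductSpace.rclikeToReal ℂ H
  have h1 := HasDerivAt.norm_sq h
  have h2 : (fun t : ℝ => ‖U.toFun t x‖ ^ 2) = fun _ => ‖x‖ ^ 2 := by
    funext t; rw [LinearIsometryEquiv.norm_map]
  rw [h2] at h1
  have h3 := h1.unique (hasDerivAt_const _ _)
  rw [U.map_zero] at h3
  have h4 : inner ℝ x y = (inner ℂ x y).re := rfl
  rw [← h4]; linarith

theorem hasGenerator_intervalIntegral [CompleteSpace H] (U : UnitaryOneParameterGroup H)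
    (x : H) (a : ℝ) :
    U.HasGenerator (∫ s in (0 : ℝ)..a, U.toFun s x) (U.toFun a x - x) := by
  have hc := U.continuous x
  have hi : ∀ p q : ℝ, IntervalIntegrable (fun s => U.toFun s x) volume p q :=
    fun p q => hc.intervalIntegrable p q
  -- By the group law, applying `U(t)` shifts the range of integration to `[t, t + a]`, so that the
  -- `t`-dependence sits only in the limits.
  have key : ∀ t : ℝ, U.toFun t (∫ s in (0 : ℝ)..a, U.toFun s x)
      = (∫ s in (0 : ℝ)..(t + a), U.toFun s x) - ∫ s in (0 : ℝ)..t, U.toFun s x := by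
    intro t
    have h1 := ((U.toFun t).toContinuousLinearEquiv.toContinuousLinearMap).intervalIntegral_comp_comm
      (hi 0 a)
    change _ = U.toFun t _ at h1
    rw [← h1, intervalIntegral.integral_interval_sub_left (hi _ _) (hi _ _)]
    have h2 := intervalIntegral.integral_comp_add_left (fun s => U.toFun s x) (a := 0) (b := a) t
    rw [add_zero] at h2
    rw [← h2]
    refine intervalIntegral.integral_congr fun s _ => ?_
    exact (U.map_add _ _ _).symm
  unfold HasGenerator
  simp only [key]
  have hd : ∀ b : ℝ, HasDerivAt (fun t => ∫ s in (0 : ℝ)..t, U.toFun s x) (U.toFun b x) b :=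
    fun b => intervalIntegral.integral_hasDerivAt_right (hi _ _)
      (hc.stronglyMeasurableAtFilter _ _) hc.continuousAt
  have h3 := (HasDerivAt.comp_add_const 0 a (by rw [zero_add]; exact hd a)).sub (hd 0)
  rwa [U.map_zero] at h3

/-- The averages `a⁻¹ ∫₀ᵃ U(s)x ds` lie in the domain and tend to `x` as `a → 0`. -/
theorem dense_hasGenerator [CompleteSpace H] (U : UnitaryOneParameterGroup H) :
    Dense {x | ∃ y, U.HasGenerator x y} := by
  intro x
  have hc := U.continuous x
  have hd : HasDerivAt (fun t => ∫ s in (0 : ℝ)..t, U.toFun s x) (U.toFun 0 x) 0 :=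
    intervalIntegral.integral_hasDerivAt_right (hc.intervalIntegrable _ _)
      (hc.stronglyMeasurableAtFilter _ _) hc.continuousAt
  rw [hasDerivAt_iff_tendsto_slope_zero, U.map_zero] at hd
  simp only [zero_add, intervalIntegral.integral_same, sub_zero] at hd
  refine mem_closure_of_tendsto hd (Eventually.of_forall fun a => ?_)
  refine ⟨a⁻¹ • (U.toFun a x - x), ?_⟩
  have h1 := HasDerivAt.const_smul a⁻¹ (U.hasGenerator_intervalIntegral x a)
  refine h1.congr_of_eventuallyEq (Eventually.of_forall fun s => ?_)
  exact (((U.toFun s).toContinuousLinearEquiv.toContinuousLinearMap).restrictScalars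
    ℝ).map_smul a⁻¹ _

/-- For `x` in the common domain the difference `U(t)x - V(t)x` stays in the domain, so by skewness
its squared norm has derivative zero; it vanishes at `t = 0`. Density of the domain does the rest.
-/
theorem ext_of_hasGenerator [CompleteSpace H]
    (h : ∀ x y, U.HasGenerator x y ↔ V.HasGenerator x y) : U = V := by
  let _ : InnerProductSpace ℝ H := InnerProductSpace.rclikeToReal ℂ H
  have hD : ∀ x y, U.HasGenerator x y → ∀ t, U.toFun t x = V.toFun t x := by
    intro x y hU
    have hV := (h x y).1 hU
    have hder : ∀ t, HasDerivAt (fun t => ‖U.toFun t x - V.toFun t x‖ ^ 2) 0 t := by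
      intro t
      have h1 := ((hU.hasDerivAt t).sub (hV.hasDerivAt t)).norm_sq
      have h2 := ((hU.toFun t).sub ((h _ _).2 (hV.toFun t))).re_inner_eq_zero
      have h4 : inner ℝ (U.toFun t x - V.toFun t x) (U.toFun t y - V.toFun t y)
        = (inner ℂ (U.toFun t x - V.toFun t x) (U.toFun t y - V.toFun t y)).re := rfl
      have h5 := h4.trans h2
      simp only [Pi.sub_apply] at h1
      rw [h5, mul_zero] at h1
      exact h1
    intro t
    have h3 := is_const_of_deriv_eq_zero (fun t => (hder t).differentiableAt)
      (fun t => (hder t).deriv) t 0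
    simp only [U.map_zero, V.map_zero, sub_self, norm_zero] at h3
    rw [← sub_eq_zero, ← norm_eq_zero]
    simpa using h3
  have heq : U.toFun = V.toFun := by
    funext t
    refine LinearIsometryEquiv.ext fun x => ?_
    have := Continuous.ext_on U.dense_hasGenerator (U.toFun t).continuous (V.toFun t).continuous
      (fun x hx => hD x hx.choose hx.choose_spec t)
    exact congrFun this x
  cases U; cases V; cases heq; rfl

/-- The resolvent equation at `-1` is solvable: `h` is the image of some `x` under one plus the
generator. -/
theorem exists_hasGenerator_sub [CompleteSpace H] (U : UnitaryOneParameterGroup H) (h : H) :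
    ∃ x, U.HasGenerator x (h - x) := by
  set g : ℝ → H := fun t => Real.exp t • U.toFun t h with hg
  have hgc : Continuous g := Real.continuous_exp.smul (U.continuous h)
  have hgi : ∀ r, IntegrableOn g (Iic r) := by
    intro r
    refine Integrable.mono' ((integrableOn_exp_Iic r).mul_const ‖h‖)
      hgc.aestronglyMeasurable (Eventually.of_forall fun t => ?_)
    rw [hg]
    simp [norm_smul, abs_of_pos (Real.exp_pos t)]
  have hint : ∀ p q : ℝ, IntervalIntegrable g volume p q := fun p q => hgc.intervalIntegrable p q
  refine ⟨∫ t in Iic (0 : ℝ), g t, ?_⟩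
  -- The solution is the Laplace-type integral `∫_{-∞}^0 eᵗ U(t)h dt`. Applying `U(r)` turns it into
  -- `e⁻ʳ ∫_{-∞}^r eᵗ U(t)h dt`, whose derivative at `0` is `h` minus the integral.
  have key : ∀ r : ℝ, U.toFun r (∫ t in Iic (0 : ℝ), g t)
      = Real.exp (-r) • ((∫ t in Iic (0 : ℝ), g t) + ∫ t in (0 : ℝ)..r, g t) := by
    intro r
    have h0 := intervalIntegral.integral_Iic_sub_Iic (hgi 0) (hgi r)
    rw [← h0, add_sub_cancel]
    have h1 := ((U.toFun r).toContinuousLinearEquiv.toContinuousLinearMap).integral_comp_comm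
      (hgi 0)
    change _ = U.toFun r _ at h1
    rw [← h1]
    have h2 := (measurePreserving_add_right volume r).setIntegral_preimage_emb
      (measurableEmbedding_addRight r) g (Iic r)
    rw [preimage_add_const_Iic, sub_self] at h2
    rw [← h2, ← integral_smul]
    refine integral_congr_ae (Eventually.of_forall fun t => ?_)
    change U.toFun r (Real.exp t • U.toFun t h) = Real.exp (-r) • g (t + r)
    rw [hg, smul_smul, ← Real.exp_add, neg_add_cancel_comm_assoc, add_comm t r, U.map_add]
    exact (((U.toFun r).toContinuousLinearEquiv.toContinuousLinearMap).restrictScalars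
      ℝ).map_smul _ _
  unfold HasGenerator
  simp only [key]
  have hd : HasDerivAt (fun t => (∫ t in Iic (0 : ℝ), g t) + ∫ s in (0 : ℝ)..t, g s) (g 0) 0 :=
    (intervalIntegral.integral_hasDerivAt_right (hint _ _)
      (hgc.stronglyMeasurableAtFilter _ _) hgc.continuousAt).const_add _
  have he : HasDerivAt (fun r : ℝ => Real.exp (-r)) (-1) 0 := by
    simpa using (hasDerivAt_neg (0 : ℝ)).exp
  have hg0 : g 0 = h := by simp [hg, U.map_zero]
  have h3 := he.smul hd
  rw [hg0, intervalIntegral.integral_same, neg_zero, Real.exp_zero, one_smul, neg_smul, one_smul,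
    add_zero, ← sub_eq_add_neg] at h3
  exact h3

/-- A graph that extends the generator of `U` and on which one plus the operator is injective is
the graph of the generator. -/
theorem isGeneratedBy_of_injective [CompleteSpace H] (U : UnitaryOneParameterGroup H)
    (A : H →ₗ.[ℂ] H)
    (hle : ∀ x y, U.HasGenerator x (-(2 * Real.pi * Complex.I : ℂ) • y) → (x, y) ∈ A.graph)
    (hinj : ∀ x y, (x, y) ∈ A.graph → (2 * Real.pi * Complex.I : ℂ) • y = x → x = 0) :
    U.IsGeneratedBy A := by
  rw [isGeneratedBy_iff]
  refine fun x y => ⟨fun hxy => ?_, hle x y⟩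
  set c : ℂ := 2 * Real.pi * Complex.I with hc
  have hc0 : c ≠ 0 := Complex.two_pi_I_ne_zero
  -- Choose `x'` in the generator's domain with the same image as `x` under one plus the operator;
  -- injectivity on the larger graph then forces `x' = x`.
  obtain ⟨x', hx'⟩ := U.exists_hasGenerator_sub (x - c • y)
  set y' : H := -(c⁻¹ • (x - c • y - x')) with hy'
  have hcy : -c • y' = x - c • y - x' := by
    rw [hy', smul_neg, neg_smul, neg_neg, smul_inv_smul₀ hc0]
  have hmem : (x', y') ∈ A.graph := hle x' y' (by rw [hcy]; exact hx')
  have hsub := A.graph.sub_mem hxy hmem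
  have h1 : x - x' = 0 := by
    refine hinj _ _ hsub ?_
    have : c • y' = -(x - c • y - x') := by rw [← hcy, neg_smul, neg_neg]
    rw [smul_sub, this]; abel
  have h2 : x' = x := (sub_eq_zero.1 h1).symm
  subst h2
  convert hx' using 1
  rw [neg_smul]; abel

variable {K : Type*} [NormedAddCommGroup K] [InnerProductSpace ℂ K]

/-- Transport of a unitary group along a unitary equivalence. -/
def conj (U : UnitaryOneParameterGroup H) (W : H ≃ₗᵢ[ℂ] K) : UnitaryOneParameterGroup K where
  toFun t := (W.symm.trans (U.toFun t)).trans W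
  map_zero x := by simp [U.map_zero]
  map_add s t x := by simp [U.map_add]
  continuous x := W.continuous.comp (U.continuous _)

theorem HasGenerator.of_conj {W : H ≃ₗᵢ[ℂ] K} {f h : K} (hf : (U.conj W).HasGenerator f h) :
    U.HasGenerator (W.symm f) (W.symm h) := by
  have h2 := (W.symm.toContinuousLinearEquiv.toContinuousLinearMap.restrictScalars
    ℝ).hasFDerivAt.comp_hasDerivAt 0 hf
  refine h2.congr_of_eventuallyEq (Eventually.of_forall fun s => ?_)
  simp [conj]

theorem HasGenerator.map {f h : H} (hf : U.HasGenerator f h) (A : H →L[ℂ] H)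
    (hA : ∀ t x, A (U.toFun t x) = U.toFun t (A x)) : U.HasGenerator (A f) (A h) := by
  have h2 := (A.restrictScalars ℝ).hasFDerivAt.comp_hasDerivAt 0 hf
  refine h2.congr_of_eventuallyEq (Eventually.of_forall fun s => ?_)
  simp [hA]

end UnitaryOneParameterGroup

/-! ### Translations of `L²(ℝ)` and their generator. -/

/-- The Hilbert space `L²(ℝ)`. -/
abbrev L2Line : Type := Lp ℂ 2 (volume : Measure ℝ)

theorem measurePreserving_sub_const (t : ℝ) :
    MeasurePreserving (fun x : ℝ => x - t) volume volume :=
  measurePreserving_sub_right volume t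

/-- Translation to the right by `t` on `L²(ℝ)`. -/
noncomputable def lineTranslation (t : ℝ) : L2Line →ₗᵢ[ℂ] L2Line :=
  Lp.compMeasurePreservingₗᵢ ℂ (fun x : ℝ => x - t) (measurePreserving_sub_const t)

theorem coeFn_lineTranslation (t : ℝ) (k : L2Line) :
    lineTranslation t k =ᵐ[volume] fun x => k (x - t) :=
  Lp.coeFn_compMeasurePreserving k (measurePreserving_sub_const t)

theorem ae_comp_sub {p : ℝ → Prop} (h : ∀ᵐ x, p x) (t : ℝ) : ∀ᵐ x, p (x - t) :=
  (measurePreserving_sub_const t).quasiMeasurePreserving.ae h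

theorem lineTranslation_add (s t : ℝ) (k : L2Line) :
    lineTranslation (s + t) k = lineTranslation s (lineTranslation t k) := by
  apply Lp.ext
  filter_upwards [coeFn_lineTranslation (s + t) k, coeFn_lineTranslation s (lineTranslation t k),
    ae_comp_sub (coeFn_lineTranslation t k) s] with x h1 h2 h3
  rw [h1, h2, h3, sub_sub]

theorem lineTranslation_comm (s t : ℝ) (k : L2Line) :
    lineTranslation s (lineTranslation t k) = lineTranslation t (lineTranslation s k) := by
  rw [← lineTranslation_add, ← lineTranslation_add, add_comm]

theorem lineTranslation_zero (k : L2Line) : lineTranslation 0 k = k := by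
  apply Lp.ext
  filter_upwards [coeFn_lineTranslation 0 k] with x h1
  rw [h1, sub_zero]

/-- The group of translations of `L²(ℝ)`. -/
noncomputable def translationGroup : UnitaryOneParameterGroup L2Line where
  toFun t := LinearIsometryEquiv.ofSurjective (lineTranslation t) fun k =>
    ⟨lineTranslation (-t) k, by
      rw [← lineTranslation_add, add_neg_cancel, lineTranslation_zero]⟩
  map_zero := lineTranslation_zero
  map_add := lineTranslation_add
  continuous k := by
    have hc : Continuous fun t : ℝ => (⟨fun x : ℝ => x - t, by fun_prop⟩ : C(ℝ, ℝ)) :=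
      ContinuousMap.continuous_of_continuous_uncurry _ (by
        simp only [Function.uncurry_def, ContinuousMap.coe_mk]; fun_prop)
    exact (continuous_const (y := k)).compMeasurePreservingLp hc measurePreserving_sub_const
      (by norm_num)

theorem L2Line.locallyIntegrable (k : L2Line) : LocallyIntegrable k volume :=
  (Lp.memLp k).locallyIntegrable (by norm_num)

theorem L2Line.intervalIntegrable (k : L2Line) (a b : ℝ) : IntervalIntegrable k volume a b :=
  intervalIntegrable_iff.mpr <|
    ((L2Line.locallyIntegrable k).integrableOn_isCompact isCompact_uIcc).mono_set uIoc_subset_uIcc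

/-- An element of the domain of the generator of translations has a representative that is an
indefinite integral. -/
theorem exists_rep_of_hasGenerator {k y : L2Line} (h : translationGroup.HasGenerator k y) :
    ∃ K : ℝ → ℂ, K =ᵐ[volume] k ∧ ∀ a b, K b - K a = -∫ x in a..b, y x := by
  have hki := L2Line.intervalIntegrable k
  have hyi := L2Line.intervalIntegrable y
  set Φ : ℝ → ℂ := fun x => ∫ s in (0 : ℝ)..x, k s with hΦ
  have hgood : ∀ᵐ a, HasDerivAt Φ (k a) a := by
    filter_upwards [_root_.LocallyIntegrable.ae_hasDerivAt_integral (L2Line.locallyIntegrable k)]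
      with a ha using ha 0
  -- Pair the orbit with the indicator of `(a, b]`. The result is `Φ(b - t) - Φ(a - t)`; its
  -- derivative at `0` is computed once from the generator and once from differentiability of `Φ` at
  -- `a` and `b`.
  have hpair : ∀ a b, a ≤ b → HasDerivAt Φ (k a) a → HasDerivAt Φ (k b) b →
      k b - k a = -∫ x in a..b, y x := by
    intro a b hab ha hb
    have hfin : volume (Ioc a b) ≠ ⊤ := by simp
    have e1 : ∀ g : L2Line, inner ℂ (indicatorConstLp 2 measurableSet_Ioc hfin (1 : ℂ)) g
        = ∫ x in a..b, g x := fun g => by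
      rw [L2.inner_indicatorConstLp_one, intervalIntegral.integral_of_le hab]
    have h1 : HasDerivAt (fun t : ℝ => ∫ x in a..b, lineTranslation t k x)
        (∫ x in a..b, y x) 0 := by
      have := ((innerSL ℂ (indicatorConstLp 2 measurableSet_Ioc hfin (1 : ℂ))).restrictScalars
        ℝ).hasFDerivAt.comp_hasDerivAt 0 h
      rw [← e1]
      refine this.congr_of_eventuallyEq (Eventually.of_forall fun t => ?_)
      exact (e1 _).symm
    have h2 : ∀ t : ℝ, ∫ x in a..b, lineTranslation t k x = Φ (b - t) - Φ (a - t) := by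
      intro t
      rw [hΦ, intervalIntegral.integral_interval_sub_left (hki _ _) (hki _ _),
        ← intervalIntegral.integral_comp_sub_right]
      refine intervalIntegral.integral_congr_ae ?_
      filter_upwards [coeFn_lineTranslation t k] with x hx _ using hx
    simp only [h2] at h1
    have h3 : ∀ c, HasDerivAt Φ (k c) c → HasDerivAt (fun t => Φ (c - t)) (-k c) 0 :=
      fun c hc => HasDerivAt.comp_const_sub c 0 (by rwa [sub_zero])
    have h4 := h1.unique ((h3 b hb).sub (h3 a ha))
    rw [h4]; ring
  have hpair' : ∀ a b, HasDerivAt Φ (k a) a → HasDerivAt Φ (k b) b →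
      k b - k a = -∫ x in a..b, y x := by
    intro a b ha hb
    rcases le_total a b with hab | hab
    · exact hpair a b hab ha hb
    · have := hpair b a hab hb ha
      rw [intervalIntegral.integral_symm, ← this]; ring
  -- Any single good point anchors the representative.
  obtain ⟨c, hc⟩ := hgood.exists
  refine ⟨fun x => k c - ∫ s in c..x, y s, ?_, fun a b => ?_⟩
  · filter_upwards [hgood] with x hx
    have := hpair' c x hc hx
    linear_combination -this
  · have := intervalIntegral.integral_interval_sub_left (hyi c b) (hyi c a)
    linear_combination -this

theorem absolutelyContinuousOnInterval_const (c : ℂ) (a b : ℝ) :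
    AbsolutelyContinuousOnInterval (fun _ : ℝ => c) a b := by
  simp [AbsolutelyContinuousOnInterval, tendsto_const_nhds]

theorem absolutelyContinuousOnInterval_integral {y : ℝ → ℂ}
    (hy : ∀ a b, IntervalIntegrable y volume a b) (c a b : ℝ) :
    AbsolutelyContinuousOnInterval (fun x => ∫ s in c..x, y s) a b := by
  have hre : ∀ a b, IntervalIntegrable (fun x => (y x).re) volume a b :=
    fun a b => ⟨(hy a b).1.re, (hy a b).2.re⟩
  have him : ∀ a b, IntervalIntegrable (fun x => (y x).im) volume a b :=
    fun a b => ⟨(hy a b).1.im, (hy a b).2.im⟩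
  have hreal : ∀ g : ℝ → ℝ, (∀ a b, IntervalIntegrable g volume a b) →
      AbsolutelyContinuousOnInterval (fun x => ∫ s in c..x, g s) a b := by
    intro g hg
    -- The base point `c` need not lie between `a` and `b`, so work on an interval containing all
    -- three and restrict afterwards.
    have h1 := (hg (min a (min b c))
      (max a (max b c))).absolutelyContinuousOnInterval_intervalIntegral
      (c := c) (by
        rw [uIcc_of_le ((min_le_left _ _).trans (le_max_left _ _))]
        exact ⟨(min_le_right _ _).trans (min_le_right _ _),
          (le_max_right _ _).trans (le_max_right _ _)⟩)
    refine h1.mono (uIcc_subset_uIcc ?_ ?_) <;>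
      rw [uIcc_of_le ((min_le_left _ _).trans (le_max_left _ _))]
    · exact ⟨min_le_left _ _, le_max_left _ _⟩
    · exact ⟨(min_le_right _ _).trans (min_le_left _ _),
          (le_max_left _ _).trans (le_max_right _ _)⟩
  have h2 := ((hreal _ hre).smul (absolutelyContinuousOnInterval_const 1 a b)).add
    ((hreal _ him).smul (absolutelyContinuousOnInterval_const Complex.I a b))
  refine (congrArg (AbsolutelyContinuousOnInterval · a b) (funext fun x => ?_)).mp h2
  symm
  have h3 : ∫ s in c..x, y s = ∫ s in c..x, (((y s).re : ℂ) + ((y s).im : ℂ) * Complex.I) := by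
    simp only [Complex.re_add_im]
  have h4 : IntervalIntegrable (fun s => ((y s).re : ℂ)) volume c x :=
    ⟨(hre c x).1.ofReal, (hre c x).2.ofReal⟩
  have h5 : IntervalIntegrable (fun s => ((y s).im : ℂ)) volume c x :=
    ⟨(him c x).1.ofReal, (him c x).2.ofReal⟩
  rw [h3, intervalIntegral.integral_add h4 (h5.mul_const _),
    intervalIntegral.integral_mul_const, intervalIntegral.integral_ofReal,
    intervalIntegral.integral_ofReal]
  simp

/-! ### Decay of translates and a contraction principle. -/

/-- A function with compact support is orthogonal to its far translates. -/
theorem eventually_inner_lineTranslation_eq_zero {u v : L2Line} {R : ℝ}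
    (hu : ∀ᵐ x, R < |x| → u x = 0) (hv : ∀ᵐ x, R < |x| → v x = 0) :
    ∀ᶠ t in atTop, inner ℂ u (lineTranslation t v) = 0 := by
  filter_upwards [eventually_gt_atTop (2 * R)] with t ht
  rw [L2.inner_def]
  rw [← integral_zero ℝ ℂ]
  refine integral_congr_ae ?_
  filter_upwards [hu, coeFn_lineTranslation t v, ae_comp_sub hv t] with x h1 h2 h3
  rw [h2]
  by_cases hx : R < |x|
  · simp [h1 hx]
  · rw [h3 ?_, inner_zero_right]
    rw [lt_abs]; right
    have := le_abs_self x
    linarith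

theorem exists_norm_sub_lt_of_compactSupport (k : L2Line) {ε : ℝ} (hε : 0 < ε) :
    ∃ u : L2Line, ‖k - u‖ < ε ∧ ∃ R : ℝ, ∀ᵐ x, R < |x| → u x = 0 := by
  obtain ⟨g, hgs, hg, -, hgm⟩ := (Lp.memLp k).exists_hasCompactSupport_eLpNorm_sub_le (by norm_num)
    (ε := ENNReal.ofReal (ε / 2)) (by simpa using hε)
  refine ⟨hgm.toLp g, ?_, ?_⟩
  · have h1 : k - hgm.toLp g = ((Lp.memLp k).sub hgm).toLp (⇑k - g) := by
      rw [MemLp.toLp_sub (Lp.memLp k) hgm, Lp.toLp_coeFn]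
    rw [h1, Lp.norm_toLp]
    refine (ENNReal.toReal_mono ENNReal.ofReal_ne_top hg).trans_lt ?_
    rw [ENNReal.toReal_ofReal (by linarith)]
    linarith
  · obtain ⟨R, hR⟩ := hgs.isCompact.isBounded.subset_closedBall 0
    refine ⟨R, ?_⟩
    filter_upwards [hgm.coeFn_toLp] with x hx hRx
    rw [hx]
    by_contra h0
    have := hR (subset_tsupport g h0)
    rw [Metric.mem_closedBall, dist_zero_right, Real.norm_eq_abs] at this
    linarith

/-- Approximate by compactly supported `v` and `u`, for which the pairing eventually vanishes. The
function `v` is chosen first because the tolerance for `u` depends on `‖v‖`. -/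
theorem tendsto_inner_lineTranslation (k l : L2Line) :
    Tendsto (fun t : ℝ => inner ℂ k (lineTranslation t l)) atTop (𝓝 0) := by
  rw [Metric.tendsto_nhds]
  intro ε hε
  obtain ⟨v, hv, Rv, hRv⟩ := exists_norm_sub_lt_of_compactSupport l
    (ε := ε / (2 * (‖k‖ + 1))) (by positivity)
  obtain ⟨u, hu, Ru, hRu⟩ := exists_norm_sub_lt_of_compactSupport k
    (ε := ε / (2 * (‖v‖ + 1))) (by positivity)
  have hz := eventually_inner_lineTranslation_eq_zero (R := max Ru Rv)
    (hRu.mono fun x hx h => hx ((le_max_left _ _).trans_lt h))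
    (hRv.mono fun x hx h => hx ((le_max_right _ _).trans_lt h))
  filter_upwards [hz] with t ht
  rw [dist_zero_right]
  have h1 : inner ℂ k (lineTranslation t l)
      = inner ℂ k (lineTranslation t (l - v)) + inner ℂ (k - u) (lineTranslation t v) := by
    rw [map_sub, inner_sub_right, inner_sub_left, ht]; ring
  have h2 : ‖inner ℂ k (lineTranslation t (l - v))‖ ≤ ‖k‖ * ‖l - v‖ := by
    simpa only [LinearIsometry.norm_map] using
      norm_inner_le_norm (𝕜 := ℂ) k (lineTranslation t (l - v))
  have h3 : ‖inner ℂ (k - u) (lineTranslation t v)‖ ≤ ‖k - u‖ * ‖v‖ := by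
    simpa only [LinearIsometry.norm_map] using
      norm_inner_le_norm (𝕜 := ℂ) (k - u) (lineTranslation t v)
  have h4 : ‖k‖ * ‖l - v‖ < ε / 2 := by
    have : (‖k‖ + 1) * ‖l - v‖ < ε / 2 := by
      rw [lt_div_iff₀ (by positivity)] at hv
      linarith
    nlinarith [norm_nonneg (l - v)]
  have h5 : ‖k - u‖ * ‖v‖ < ε / 2 := by
    have : (‖v‖ + 1) * ‖k - u‖ < ε / 2 := by
      rw [lt_div_iff₀ (by positivity)] at hu
      linarith
    nlinarith [norm_nonneg (k - u)]
  rw [h1]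
  exact (norm_add_le _ _).trans_lt (by linarith)

/-- If `u = q T(τ) u` on a set that is stable under `x ↦ x - τ` and `|q| < 1`, then `u` vanishes
on this set. -/
theorem ae_eq_zero_of_eq_mul_comp_sub {u : ℝ → ℂ} (hu : MemLp u 2 volume) {s : Set ℝ}
    (hs : MeasurableSet s) {τ : ℝ} (hsτ : ∀ x ∈ s, x - τ ∈ s) {q : ℂ} (hq : ‖q‖ < 1)
    (h : ∀ᵐ x, x ∈ s → u x = q * u (x - τ)) : ∀ᵐ x, x ∈ s → u x = 0 := by
  have hi : Integrable (fun x => ‖u x‖ ^ 2) volume := hu.integrable_norm_pow (by norm_num)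
  have hmp := measurePreserving_sub_const τ
  have hiτ : Integrable (fun x => ‖u (x - τ)‖ ^ 2) volume :=
    hmp.integrable_comp_of_integrable hi
  have h1 : ∫ x in s, ‖u x‖ ^ 2 = ∫ x in s, ‖q‖ ^ 2 * ‖u (x - τ)‖ ^ 2 := by
    refine setIntegral_congr_ae hs ?_
    filter_upwards [h] with x hx hxs
    rw [hx hxs, norm_mul, mul_pow]
  -- Stability says that `s` lies in its preimage under `x ↦ x - τ`. With `h1` the integral over `s`
  -- is at most `‖q‖² < 1` times itself, hence zero.
  have h2 : ∫ x in s, ‖u (x - τ)‖ ^ 2 ≤ ∫ x in s, ‖u x‖ ^ 2 := by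
    have e := hmp.setIntegral_preimage_emb (measurableEmbedding_subRight τ)
      (fun x => ‖u x‖ ^ 2) s
    rw [← e]
    exact setIntegral_mono_set hiτ.integrableOn (Eventually.of_forall fun x => by positivity)
      (Eventually.of_forall fun x hx => hsτ x hx)
  rw [integral_const_mul] at h1
  have h0 : 0 ≤ ∫ x in s, ‖u x‖ ^ 2 := setIntegral_nonneg hs fun x _ => by positivity
  have hq2 : ‖q‖ ^ 2 < 1 := by nlinarith [norm_nonneg q]
  have h3 : ∫ x in s, ‖u x‖ ^ 2 = 0 := by nlinarith [sq_nonneg ‖q‖]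
  rw [setIntegral_eq_zero_iff_of_nonneg_ae (Eventually.of_forall fun x => by positivity)
    hi.integrableOn] at h3
  rw [Filter.EventuallyEq, ae_restrict_iff' hs] at h3
  filter_upwards [h3] with x hx hxs
  simpa using hx hxs

theorem norm_sq_eq_integral_norm_sq {μ : Measure ℝ} (f : Lp ℂ 2 μ) :
    ‖f‖ ^ 2 = ∫ x, ‖f x‖ ^ 2 ∂μ := by
  have h := L2.inner_def (𝕜 := ℂ) f f
  simp only [inner_self_eq_norm_sq_to_K] at h
  have h2 : ∫ x, ((‖f x‖ : ℂ)) ^ 2 ∂μ = ((∫ x, ‖f x‖ ^ 2 ∂μ : ℝ) : ℂ) := by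
    rw [← integral_complex_ofReal]
    simp
  refine Complex.ofReal_injective ?_
  rw [← h2, Complex.ofReal_pow]
  exact h

/-! ### Unitary `2 × 2` matrices -/

section Unitary

variable {B : Matrix (Fin 2) (Fin 2) ℂ}

theorem unitary_columns (hB : B ∈ Matrix.unitaryGroup (Fin 2) ℂ) (i j : Fin 2) :
    star (B 0 i) * B 0 j + star (B 1 i) * B 1 j = (1 : Matrix (Fin 2) (Fin 2) ℂ) i j := by
  rw [← Matrix.mem_unitaryGroup_iff'.1 hB]
  simp [Matrix.mul_apply, Fin.sum_univ_two]

theorem unitary_rows (hB : B ∈ Matrix.unitaryGroup (Fin 2) ℂ) (i j : Fin 2) :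
    B i 0 * star (B j 0) + B i 1 * star (B j 1) = (1 : Matrix (Fin 2) (Fin 2) ℂ) i j := by
  rw [← Matrix.mem_unitaryGroup_iff.1 hB]
  simp [Matrix.mul_apply, Fin.sum_univ_two]

theorem unitary_norm_sq_add (hB : B ∈ Matrix.unitaryGroup (Fin 2) ℂ) (x y : ℂ) :
    ‖B 0 0 * x + B 0 1 * y‖ ^ 2 + ‖B 1 0 * x + B 1 1 * y‖ ^ 2 = ‖x‖ ^ 2 + ‖y‖ ^ 2 := by
  have e00 := unitary_columns hB 0 0
  have e01 := unitary_columns hB 0 1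
  have e10 := unitary_columns hB 1 0
  have e11 := unitary_columns hB 1 1
  simp only [Matrix.one_apply, if_true, Fin.zero_eq_one_iff, Fin.one_eq_zero_iff,
    OfNat.ofNat_ne_one, if_false, ← starRingEnd_apply] at e00 e01 e10 e11
  have : ((‖B 0 0 * x + B 0 1 * y‖ ^ 2 + ‖B 1 0 * x + B 1 1 * y‖ ^ 2 : ℝ) : ℂ)
      = ((‖x‖ ^ 2 + ‖y‖ ^ 2 : ℝ) : ℂ) := by
    push_cast
    simp only [← Complex.conj_mul', map_add, map_mul]
    linear_combination (starRingEnd ℂ x) * x * e00 + (starRingEnd ℂ x) * y * e01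
      + (starRingEnd ℂ y) * x * e10 + (starRingEnd ℂ y) * y * e11
  exact_mod_cast this

end Unitary

/-! ### Geometric series of translations -/

/-- The operator `(1 - q T(τ))⁻¹` on `L²(ℝ)`. -/
noncomputable def geometricTranslation (q : ℂ) (τ : ℝ) : L2Line →L[ℂ] L2Line :=
  Ring.inverse (1 - q • (lineTranslation τ).toContinuousLinearMap)

/-- Neumann series, as translation is isometric. This is what makes `Ring.inverse` in
`geometricTranslation` a genuine inverse rather than its default value `0`. -/
theorem isUnit_one_sub_smul_lineTranslation {q : ℂ} (hq : ‖q‖ < 1) (τ : ℝ) :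
    IsUnit (1 - q • (lineTranslation τ).toContinuousLinearMap) := by
  refine isUnit_one_sub_of_norm_lt_one ?_
  rw [norm_smul]
  have h1 : ‖(lineTranslation τ).toContinuousLinearMap‖ ≤ 1 :=
    LinearIsometry.norm_toContinuousLinearMap_le _
  nlinarith [norm_nonneg q]

theorem geometricTranslation_eq {q : ℂ} (hq : ‖q‖ < 1) (τ : ℝ) (k : L2Line) :
    geometricTranslation q τ k = q • lineTranslation τ (geometricTranslation q τ k) + k := by
  have h := Ring.mul_inverse_cancel _ (isUnit_one_sub_smul_lineTranslation hq τ)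
  have h2 := congrArg (fun A : L2Line →L[ℂ] L2Line => A k) h
  change geometricTranslation q τ k - q • lineTranslation τ (geometricTranslation q τ k) = k at h2
  rw [← sub_eq_iff_eq_add']
  exact h2

theorem geometricTranslation_comm {q : ℂ} (hq : ‖q‖ < 1) (τ t : ℝ) (k : L2Line) :
    geometricTranslation q τ (lineTranslation t k)
      = lineTranslation t (geometricTranslation q τ k) := by
  have h : Commute (1 - q • (lineTranslation τ).toContinuousLinearMap)
      (lineTranslation t).toContinuousLinearMap := by
    refine (Commute.one_left _).sub_left (Commute.smul_left ?_ q)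
    exact ContinuousLinearMap.ext fun k => lineTranslation_comm τ t k
  obtain ⟨u, hu⟩ := isUnit_one_sub_smul_lineTranslation hq τ
  rw [← hu] at h
  have h2 : Commute (geometricTranslation q τ) (lineTranslation t).toContinuousLinearMap := by
    rw [geometricTranslation, ← hu, Ring.inverse_unit]
    exact h.units_inv_left
  exact congrArg (fun A : L2Line →L[ℂ] L2Line => A k) h2.eq

/-! ### Gluing functions on the components of the exterior domain -/

/-- The function that is given by `u₀`, `u₁(· - α)`, `u₂(· - β)` on the three components of the
exterior domain. -/
noncomputable def glue (α β : ℝ) (u₀ u₁ u₂ : ℝ → ℂ) (x : ℝ) : ℂ :=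
  if x < 0 then u₀ x else if x < α then u₁ (x - α) else u₂ (x - β)

section Glue

variable {α β : ℝ} {u₀ u₁ u₂ v₀ v₁ v₂ : ℝ → ℂ} {x : ℝ}

theorem glue_of_neg (hx : x < 0) : glue α β u₀ u₁ u₂ x = u₀ x := if_pos hx

theorem glue_of_mem_Ioo (hx : x ∈ Ioo 1 α) : glue α β u₀ u₁ u₂ x = u₁ (x - α) := by
  rw [glue, if_neg (by linarith [hx.1]), if_pos hx.2]

theorem glue_of_gt (hα : 1 < α) (hαβ : α < β) (hx : β < x) :
    glue α β u₀ u₁ u₂ x = u₂ (x - β) := by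
  rw [glue, if_neg (by linarith), if_neg (by linarith)]

theorem memLp_glue (hα : 1 < α) (h₀ : MemLp u₀ 2 volume) (h₁ : MemLp u₁ 2 volume)
    (h₂ : MemLp u₂ 2 volume) : MemLp (glue α β u₀ u₁ u₂) 2 volume := by
  have h1 := h₁.comp_measurePreserving (measurePreserving_sub_const α)
  have h2 := h₂.comp_measurePreserving (measurePreserving_sub_const β)
  -- The branches of `glue` partition the whole line at `0` and `α`; its values on the gaps outside
  -- the exterior domain never matter.
  have h := ((h₀.indicator (measurableSet_Iio (a := 0))).add
    (h1.indicator (measurableSet_Ico (a := 0) (b := α)))).add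
    (h2.indicator (measurableSet_Ici (a := α)))
  refine (congrArg (MemLp · 2 volume) (funext fun x => ?_)).mp h
  simp only [Pi.add_apply, indicator, mem_Iio, mem_Ico, mem_Ici, glue, Function.comp]
  by_cases h1 : x < 0
  · simp [h1, not_le.2 h1, show ¬ α ≤ x by linarith]
  · by_cases h2 : x < α
    · simp [h1, h2, not_lt.1 h1, not_le.2 h2]
    · simp [h1, h2, not_lt.1 h2]

theorem glue_ae_congr (h₀ : u₀ =ᵐ[volume] v₀) (h₁ : u₁ =ᵐ[volume] v₁) (h₂ : u₂ =ᵐ[volume] v₂) :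
    glue α β u₀ u₁ u₂ =ᵐ[volume] glue α β v₀ v₁ v₂ := by
  filter_upwards [h₀, ae_comp_sub h₁ α, ae_comp_sub h₂ β] with x h0 h1 h2
  simp only [glue, h0, h1, h2]

theorem ae_exteriorDomain_iff {p : ℝ → Prop} :
    (∀ᵐ x ∂volume.restrict (exteriorDomain α β), p x) ↔ ∀ᵐ x, x ∈ exteriorDomain α β → p x :=
  ae_restrict_iff' (isOpen_exteriorDomain α β).measurableSet

theorem setIntegral_exteriorDomain (hα : 1 < α) (hαβ : α < β) {f : ℝ → ℝ}
    (hf : IntegrableOn f (exteriorDomain α β)) :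
    ∫ x in exteriorDomain α β, f x
      = (∫ x in Iio 0, f x) + (∫ x in Ioo 1 α, f x) + ∫ x in Ioi β, f x := by
  have hd1 : Disjoint (Iio (0 : ℝ)) (Ioo 1 α) := by
    rw [Set.disjoint_left]; intro x hx hx'; linarith [mem_Iio.1 hx, hx'.1]
  have hd2 : Disjoint (Iio (0 : ℝ) ∪ Ioo 1 α) (Ioi β) := by
    rw [Set.disjoint_left]
    rintro x (hx | hx) hx'
    · linarith [mem_Iio.1 hx, mem_Ioi.1 hx']
    · linarith [hx.2, mem_Ioi.1 hx']
  have h12 := hf.mono_set (subset_union_left (s := Iio 0 ∪ Ioo 1 α) (t := Ioi β))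
  rw [exteriorDomain, setIntegral_union hd2 measurableSet_Ioi h12
    (hf.mono_set subset_union_right),
    setIntegral_union hd1 measurableSet_Ioo (h12.mono_set subset_union_left)
    (h12.mono_set subset_union_right)]

theorem setIntegral_comp_sub (f : ℝ → ℝ) (s : Set ℝ) (t : ℝ) :
    ∫ x in (fun x => x - t) ⁻¹' s, f (x - t) = ∫ x in s, f x :=
  (measurePreserving_sub_const t).setIntegral_preimage_emb (measurableEmbedding_subRight t) f s

theorem setIntegral_norm_sq_glue (hα : 1 < α) (hαβ : α < β) (h₀ : MemLp u₀ 2 volume)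
    (h₁ : MemLp u₁ 2 volume) (h₂ : MemLp u₂ 2 volume) :
    ∫ x in exteriorDomain α β, ‖glue α β u₀ u₁ u₂ x‖ ^ 2
      = (∫ x in Iio 0, ‖u₀ x‖ ^ 2) + (∫ x in Ioo (1 - α) 0, ‖u₁ x‖ ^ 2)
        + ∫ x in Ioi 0, ‖u₂ x‖ ^ 2 := by
  have hi : Integrable (fun x => ‖glue α β u₀ u₁ u₂ x‖ ^ 2) volume :=
    (memLp_glue hα h₀ h₁ h₂).integrable_norm_pow (by norm_num)
  rw [setIntegral_exteriorDomain hα hαβ hi.integrableOn]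
  congr 1; congr 1
  · exact setIntegral_congr_fun measurableSet_Iio fun x hx => by
      simp only [glue_of_neg (mem_Iio.1 hx)]
  · rw [← setIntegral_comp_sub _ (Ioo (1 - α) 0) α, preimage_sub_const_Ioo, sub_add_cancel, zero_add]
    exact setIntegral_congr_fun measurableSet_Ioo fun x hx => by
      simp only [glue_of_mem_Ioo hx]
  · rw [← setIntegral_comp_sub _ (Ioi 0) β, preimage_sub_const_Ioi, zero_add]
    exact setIntegral_congr_fun measurableSet_Ioi fun x hx => by
      simp only [glue_of_gt hα hαβ (mem_Ioi.1 hx)]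

end Glue

/-! ### The outgoing translation representation -/

/-- The wave at the right end point of a bounded component of length `L`, as a function of the wave
that leaves through the unbounded component on the right. -/
noncomputable def interiorWave (B : Matrix (Fin 2) (Fin 2) ℂ) (L : ℝ) : L2Line →L[ℂ] L2Line :=
  B 1 1 • geometricTranslation (B 1 0) L

/-- The wave that enters from the left, as a function of the wave that leaves through the unbounded
component on the right. -/
noncomputable def incomingWave (B : Matrix (Fin 2) (Fin 2) ℂ) (L : ℝ) : L2Line →L[ℂ] L2Line :=
  B 0 0 • (lineTranslation L).toContinuousLinearMap ∘L interiorWave B L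
    + B 0 1 • ContinuousLinearMap.id ℂ L2Line

section Wave

variable {B : Matrix (Fin 2) (Fin 2) ℂ} {α β : ℝ}

theorem coeFn_interiorWave (hq : ‖B 1 0‖ < 1) (L : ℝ) (k : L2Line) :
    ∀ᵐ x, interiorWave B L k x = B 1 0 * interiorWave B L k (x - L) + B 1 1 * k x := by
  have h : interiorWave B L k = B 1 0 • lineTranslation L (interiorWave B L k) + B 1 1 • k := by
    change B 1 1 • geometricTranslation (B 1 0) L k
      = B 1 0 • lineTranslation L (B 1 1 • geometricTranslation (B 1 0) L k) + B 1 1 • k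
    rw [map_smul, smul_comm (B 1 0), ← smul_add, ← geometricTranslation_eq hq]
  filter_upwards [Lp.coeFn_add (B 1 0 • lineTranslation L (interiorWave B L k)) (B 1 1 • k),
    Lp.coeFn_smul (B 1 0) (lineTranslation L (interiorWave B L k)), Lp.coeFn_smul (B 1 1) k,
    coeFn_lineTranslation L (interiorWave B L k)] with x h1 h2 h3 h4
  conv_lhs => rw [h]
  rw [h1, Pi.add_apply, h2, h3, Pi.smul_apply, Pi.smul_apply, h4, smul_eq_mul, smul_eq_mul]

theorem coeFn_incomingWave (L : ℝ) (k : L2Line) :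
    ∀ᵐ x, incomingWave B L k x = B 0 0 * interiorWave B L k (x - L) + B 0 1 * k x := by
  have h : incomingWave B L k = B 0 0 • lineTranslation L (interiorWave B L k) + B 0 1 • k := rfl
  filter_upwards [Lp.coeFn_add (B 0 0 • lineTranslation L (interiorWave B L k)) (B 0 1 • k),
    Lp.coeFn_smul (B 0 0) (lineTranslation L (interiorWave B L k)), Lp.coeFn_smul (B 0 1) k,
    coeFn_lineTranslation L (interiorWave B L k)] with x h1 h2 h3 h4
  rw [h, h1, Pi.add_apply, h2, h3, Pi.smul_apply, Pi.smul_apply, h4, smul_eq_mul, smul_eq_mul]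

theorem interiorWave_comm (hq : ‖B 1 0‖ < 1) (L t : ℝ) (k : L2Line) :
    interiorWave B L (lineTranslation t k) = lineTranslation t (interiorWave B L k) := by
  change B 1 1 • geometricTranslation (B 1 0) L (lineTranslation t k)
    = lineTranslation t (B 1 1 • geometricTranslation (B 1 0) L k)
  rw [map_smul, geometricTranslation_comm hq]

/-- The function on the exterior domain with outgoing wave `k`. -/
noncomputable def exteriorFun (α β : ℝ) (B : Matrix (Fin 2) (Fin 2) ℂ) (k : L2Line) : ℝ → ℂ :=
  glue α β (incomingWave B (α - 1) k) (interiorWave B (α - 1) k) k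

theorem memLp_exteriorFun (hα : 1 < α) (k : L2Line) :
    MemLp (exteriorFun α β B k) 2 (volume.restrict (exteriorDomain α β)) :=
  (memLp_glue hα (Lp.memLp _) (Lp.memLp _) (Lp.memLp _)).restrict _

/-- Conservation of energy. Unitarity of `B` gives `|n(x)|² + |m(x)|² = |m(x - L)|² + |k(x)|²`
pointwise. Integrated over `x < 0`, the two `m` terms differ exactly by the integral of `|m|²` over
`(1 - α, 0)`, the energy in the bounded component. -/
theorem setIntegral_norm_sq_exteriorFun (hα : 1 < α) (hαβ : α < β)
    (hB : B ∈ Matrix.unitaryGroup (Fin 2) ℂ) (hq : ‖B 1 0‖ < 1) (k : L2Line) :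
    ∫ x in exteriorDomain α β, ‖exteriorFun α β B k x‖ ^ 2 = ∫ x, ‖k x‖ ^ 2 := by
  set L := α - 1 with hL
  set m := interiorWave B L k with hm
  set n := incomingWave B L k with hn
  have hint : ∀ u : L2Line, Integrable (fun x => ‖u x‖ ^ 2) volume :=
    fun u => (Lp.memLp u).integrable_norm_pow (by norm_num)
  have hintL : Integrable (fun x => ‖m (x - L)‖ ^ 2) volume :=
    (measurePreserving_sub_const L).integrable_comp_of_integrable (hint m)
  rw [exteriorFun, setIntegral_norm_sq_glue hα hαβ (Lp.memLp _) (Lp.memLp _) (Lp.memLp _)]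
  have h1 : (∫ x in Iio 0, ‖n x‖ ^ 2) + ∫ x in Iio 0, ‖m x‖ ^ 2
      = (∫ x in Iio 0, ‖m (x - L)‖ ^ 2) + ∫ x in Iio 0, ‖k x‖ ^ 2 := by
    rw [← integral_add (hint n).integrableOn (hint m).integrableOn,
      ← integral_add hintL.integrableOn (hint k).integrableOn]
    refine setIntegral_congr_ae measurableSet_Iio ?_
    filter_upwards [coeFn_interiorWave hq L k, coeFn_incomingWave (B := B) L k] with x h1 h2 _
    rw [hn, h2, hm, h1]
    exact unitary_norm_sq_add hB _ _
  have h2 : ∫ x in Iio 0, ‖m (x - L)‖ ^ 2 = ∫ x in Iio (1 - α), ‖m x‖ ^ 2 := by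
    rw [← setIntegral_comp_sub (fun x => ‖m x‖ ^ 2) (Iio (1 - α)) L, preimage_sub_const_Iio]
    congr 3
    rw [hL]; ring
  have h3 : ∫ x in Iio 0, ‖m x‖ ^ 2
      = (∫ x in Iio (1 - α), ‖m x‖ ^ 2) + ∫ x in Ioo (1 - α) 0, ‖m x‖ ^ 2 := by
    rw [← integral_Ico_eq_integral_Ioo, ← setIntegral_union _ measurableSet_Ico
      (hint m).integrableOn (hint m).integrableOn, Iio_union_Ico_eq_Iio (by linarith)]
    rw [Set.disjoint_left]
    intro x hx hx'
    exact absurd hx'.1 (not_le.2 hx)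
  have h4 : ∫ x, ‖k x‖ ^ 2 = (∫ x in Iio 0, ‖k x‖ ^ 2) + ∫ x in Ioi 0, ‖k x‖ ^ 2 := by
    rw [← integral_Ici_eq_integral_Ioi, ← compl_Iio,
      integral_add_compl measurableSet_Iio (hint k)]
  rw [h4]
  change (∫ x in Iio 0, ‖n x‖ ^ 2) + (∫ x in Ioo (1 - α) 0, ‖m x‖ ^ 2) + _ = _
  linarith

/-- The isometry that maps an outgoing wave to the state on the exterior domain. -/
noncomputable def exteriorIsometry (hα : 1 < α) (hαβ : α < β)
    (hB : B ∈ Matrix.unitaryGroup (Fin 2) ℂ) (hq : ‖B 1 0‖ < 1) :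
    L2Line →ₗᵢ[ℂ] L2Exterior α β where
  toFun k := (memLp_exteriorFun (B := B) hα k).toLp
  map_add' k l := by
    rw [← MemLp.toLp_add, MemLp.toLp_eq_toLp_iff]
    refine ae_restrict_of_ae ?_
    have h := glue_ae_congr (α := α) (β := β)
      (Lp.coeFn_add (incomingWave B (α - 1) k) (incomingWave B (α - 1) l))
      (Lp.coeFn_add (interiorWave B (α - 1) k) (interiorWave B (α - 1) l)) (Lp.coeFn_add k l)
    filter_upwards [h] with x hx
    rw [exteriorFun, map_add, map_add, hx]
    simp only [Pi.add_apply, exteriorFun, glue]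
    split_ifs <;> rfl
  map_smul' c k := by
    rw [RingHom.id_apply, ← MemLp.toLp_const_smul, MemLp.toLp_eq_toLp_iff]
    refine ae_restrict_of_ae ?_
    have h := glue_ae_congr (α := α) (β := β)
      (Lp.coeFn_smul c (incomingWave B (α - 1) k))
      (Lp.coeFn_smul c (interiorWave B (α - 1) k)) (Lp.coeFn_smul c k)
    filter_upwards [h] with x hx
    rw [exteriorFun, map_smul, map_smul, hx]
    simp only [Pi.smul_apply, exteriorFun, glue]
    split_ifs <;> rfl
  norm_map' k := by
    rw [← sq_eq_sq₀ (norm_nonneg _) (norm_nonneg _), norm_sq_eq_integral_norm_sq,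
      norm_sq_eq_integral_norm_sq, ← setIntegral_norm_sq_exteriorFun hα hαβ hB hq k]
    refine integral_congr_ae ?_
    filter_upwards [(memLp_exteriorFun (B := B) (β := β) hα k).coeFn_toLp] with x hx
    exact congrArg (fun z : ℂ => ‖z‖ ^ 2) hx

theorem coeFn_exteriorIsometry (hα : 1 < α) (hαβ : α < β)
    (hB : B ∈ Matrix.unitaryGroup (Fin 2) ℂ) (hq : ‖B 1 0‖ < 1) (k : L2Line) :
    exteriorIsometry hα hαβ hB hq k =ᵐ[volume.restrict (exteriorDomain α β)]
      exteriorFun α β B k :=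
  (memLp_exteriorFun hα k).coeFn_toLp

theorem memLp_indicator_of_subset {s : Set ℝ} (hs : MeasurableSet s)
    (hsub : s ⊆ exteriorDomain α β) (f : L2Exterior α β) : MemLp (s.indicator f) 2 volume := by
  rw [memLp_indicator_iff_restrict hs]
  exact (Lp.memLp f).mono_measure (Measure.restrict_mono_set _ hsub)

theorem Iio_subset_exteriorDomain (α β : ℝ) : Iio 0 ⊆ exteriorDomain α β :=
  fun _ hx => Or.inl (Or.inl hx)

theorem Ioo_subset_exteriorDomain (α β : ℝ) : Ioo 1 α ⊆ exteriorDomain α β :=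
  fun _ hx => Or.inl (Or.inr hx)

theorem Ioi_subset_exteriorDomain (α β : ℝ) : Ioi β ⊆ exteriorDomain α β :=
  fun _ hx => Or.inr hx

/-- The wave at the right end point of the bounded component, propagated from a state on the
exterior domain. -/
theorem exists_interior_of_state (hα : 1 < α) (hq : ‖B 1 0‖ < 1) (f : L2Exterior α β) :
    ∃ p : L2Line, (∀ᵐ x, 0 ≤ x → p x = 0) ∧
      (∀ᵐ x, x ∈ Ioo (1 - α) 0 → p x = f (x + α)) ∧
      ∀ᵐ x, x < 0 → p (x - (α - 1)) = star (B 0 0) * f x + star (B 1 0) * p x := by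
  set L := α - 1 with hL
  have hm0 := memLp_indicator_of_subset measurableSet_Iio (Iio_subset_exteriorDomain α β) f
  have hm1 := memLp_indicator_of_subset measurableSet_Ioo (Ioo_subset_exteriorDomain α β) f
  have hq' : ‖star (B 1 0)‖ < 1 := by rwa [norm_star]
  -- The first row of `B*` reads `m(x - L) = star (B 0 0) * n(x) + star (B 1 0) * m(x)`. Replacing
  -- `x` by `x + L` gives a recursion from right to left, whose source `r` consists of the data of
  -- `f` on `(1, α)` and on `(-∞, 0)`.
  set r : L2Line := lineTranslation (-α) hm1.toLp + star (B 0 0) • lineTranslation (-L) hm0.toLp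
  set p : L2Line := geometricTranslation (star (B 1 0)) (-L) r with hp
  have hp_ae : ∀ᵐ x, p x = star (B 1 0) * p (x + L) + ((Ioo 1 α).indicator f (x + α)
      + star (B 0 0) * (Iio 0).indicator f (x + L)) := by
    have h := geometricTranslation_eq hq' (-L) r
    rw [← hp] at h
    filter_upwards [Lp.coeFn_add (star (B 1 0) • lineTranslation (-L) p) r,
      Lp.coeFn_smul (star (B 1 0)) (lineTranslation (-L) p), coeFn_lineTranslation (-L) p,
      Lp.coeFn_add (lineTranslation (-α) hm1.toLp) (star (B 0 0) • lineTranslation (-L) hm0.toLp),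
      Lp.coeFn_smul (star (B 0 0)) (lineTranslation (-L) hm0.toLp),
      coeFn_lineTranslation (-α) hm1.toLp, coeFn_lineTranslation (-L) hm0.toLp,
      ae_comp_sub hm1.coeFn_toLp (-α), ae_comp_sub hm0.coeFn_toLp (-L)]
      with x h1 h2 h3 h4 h5 h6 h7 h8 h9
    conv_lhs => rw [h]
    rw [h1, Pi.add_apply, h2, Pi.smul_apply, h3, h4, Pi.add_apply, h5, Pi.smul_apply, h6, h7, h8,
      h9]
    simp only [sub_neg_eq_add, smul_eq_mul]
  -- The source vanishes on `[0, ∞)`, which is stable under `x ↦ x + L`, so the contraction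
  -- principle applies with `τ = -L`.
  have hp0 : ∀ᵐ x, 0 ≤ x → p x = 0 := by
    refine ae_eq_zero_of_eq_mul_comp_sub (s := Ici 0) (Lp.memLp p) measurableSet_Ici (τ := -L)
      (fun x hx => ?_) hq' ?_
    · rw [mem_Ici] at *; linarith
    · filter_upwards [hp_ae] with x hx hx0
      rw [mem_Ici] at hx0
      rw [hx, indicator_of_notMem (by simp [hx0]), indicator_of_notMem (by
        rw [mem_Iio]; linarith), sub_neg_eq_add]
      ring
  refine ⟨p, hp0, ?_, ?_⟩
  · filter_upwards [hp_ae, ae_comp_sub hp0 (-L)] with x hx hx0 hxm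
    rw [sub_neg_eq_add] at hx0
    rw [hx, hx0 (by linarith [hxm.1]), indicator_of_mem
      (show x + α ∈ Ioo 1 α from ⟨by linarith [hxm.1], by linarith [hxm.2]⟩),
      indicator_of_notMem (by rw [mem_Iio]; linarith [hxm.1])]
    ring
  · filter_upwards [ae_comp_sub hp_ae L] with x hx hx0
    rw [hx, sub_add_cancel, indicator_of_mem (mem_Iio.2 hx0), indicator_of_notMem (by
      rw [mem_Ioo, not_and_or]; left; linarith)]
    ring

theorem exteriorIsometry_surjective (hα : 1 < α) (hαβ : α < β)
    (hB : B ∈ Matrix.unitaryGroup (Fin 2) ℂ) (hq : ‖B 1 0‖ < 1) :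
    Function.Surjective (exteriorIsometry (β := β) hα hαβ hB hq) := by
  intro f
  obtain ⟨p, hp0, hp1, hp2⟩ := exists_interior_of_state (B := B) hα hq f
  have hm0 := memLp_indicator_of_subset measurableSet_Iio (Iio_subset_exteriorDomain α β) f
  have hm2 := (memLp_indicator_of_subset measurableSet_Ioi (Ioi_subset_exteriorDomain α β)
    f).comp_measurePreserving (measurePreserving_sub_const (-β))
  -- For `x < 0` the outgoing wave is given by the second row of `B*`; for `x > 0` it is `f` on `(β,
  -- ∞)`, shifted.
  have hmk := ((hm0.const_smul (star (B 0 1))).add ((Lp.memLp p).const_smul (star (B 1 1)))).add hm2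
  set k : L2Line := hmk.toLp with hk
  have hk_ae : ∀ᵐ x, k x = star (B 0 1) * (Iio 0).indicator f x + star (B 1 1) * p x
      + (Ioi β).indicator f (x + β) := by
    filter_upwards [hmk.coeFn_toLp] with x hx
    rw [hk, hx]
    simp [Function.comp]
  have r00 := unitary_rows hB 0 0
  have r01 := unitary_rows hB 0 1
  have r10 := unitary_rows hB 1 0
  have r11 := unitary_rows hB 1 1
  simp only [Matrix.one_apply, if_true, Fin.zero_eq_one_iff, Fin.one_eq_zero_iff,
    OfNat.ofNat_ne_one, if_false] at r00 r01 r10 r11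
  have hkneg : ∀ᵐ x, x < 0 → k x = star (B 0 1) * f x + star (B 1 1) * p x := by
    filter_upwards [hk_ae] with x hx hx0
    rw [hx, indicator_of_mem (mem_Iio.2 hx0), indicator_of_notMem (by rw [mem_Ioi]; linarith),
      add_zero]
  set L := α - 1 with hL
  set m := interiorWave B L k with hm
  -- By the row relations of `B`, `p` satisfies the same recursion on `x < 0` as `m`, so `m - p`
  -- satisfies the homogeneous one and vanishes by contraction.
  have hmp : ∀ᵐ x, x < 0 → m x = p x := by
    have h := ae_eq_zero_of_eq_mul_comp_sub (s := Iio 0) ((Lp.memLp m).sub (Lp.memLp p))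
      measurableSet_Iio (τ := L) (fun x hx => by rw [mem_Iio] at *; linarith) hq (by
        filter_upwards [coeFn_interiorWave hq L k, hp2, hkneg] with x h1 h2 h3 hx0
        rw [mem_Iio] at hx0
        rw [Pi.sub_apply, Pi.sub_apply, h2 hx0, hm, h1, h3 hx0]
        linear_combination f x * r10 + p x * r11)
    filter_upwards [h] with x hx hx0
    exact sub_eq_zero.1 (hx hx0)
  refine ⟨k, Lp.ext ((coeFn_exteriorIsometry hα hαβ hB hq k).trans ?_)⟩
  refine ae_exteriorDomain_iff.2 ?_
  filter_upwards [coeFn_incomingWave (B := B) L k, hkneg, hmp, ae_comp_sub hmp L, hp2,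
    ae_comp_sub hmp α, ae_comp_sub hp1 α, ae_comp_sub hk_ae β, ae_comp_sub hp0 β]
    with x h1 h2 h3 h4 h5 h6 h7 h8 h9 hx
  rcases hx with (hx | hx) | hx
  · rw [mem_Iio] at hx
    rw [exteriorFun, glue_of_neg hx, h1, ← hm, h4 (by linarith), h5 hx, h2 hx]
    linear_combination f x * r00 + p x * r01
  · have hxα : x - α ∈ Ioo (1 - α) 0 := ⟨by linarith [hx.1], by linarith [hx.2]⟩
    rw [exteriorFun, glue_of_mem_Ioo hx, ← hm, h6 hxα.2, h7 hxα, sub_add_cancel]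
  · rw [mem_Ioi] at hx
    rw [exteriorFun, glue_of_gt hα hαβ hx, h8, h9 (by linarith),
      indicator_of_notMem (by rw [mem_Iio]; linarith), sub_add_cancel,
      indicator_of_mem (mem_Ioi.2 hx)]
    ring

/-- The unitary equivalence between outgoing waves and states on the exterior domain. -/
noncomputable def exteriorEquiv (hα : 1 < α) (hαβ : α < β)
    (hB : B ∈ Matrix.unitaryGroup (Fin 2) ℂ) (hq : ‖B 1 0‖ < 1) :
    L2Line ≃ₗᵢ[ℂ] L2Exterior α β :=
  LinearIsometryEquiv.ofSurjective (exteriorIsometry hα hαβ hB hq)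
    (exteriorIsometry_surjective hα hαβ hB hq)

end Wave

/-! ### Primitives of square integrable functions -/

/-- `F` is an indefinite integral of the square integrable function `y`. -/
structure IsPrimitive (F y : ℝ → ℂ) : Prop where
  memLp : MemLp y 2 volume
  sub_eq : ∀ a b, F b - F a = ∫ x in a..b, y x

namespace IsPrimitive

variable {F G y z : ℝ → ℂ}

theorem locallyIntegrable (h : IsPrimitive F y) : LocallyIntegrable y volume :=
  h.memLp.locallyIntegrable (by norm_num)

theorem intervalIntegrable (h : IsPrimitive F y) (a b : ℝ) : IntervalIntegrable y volume a b :=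
  intervalIntegrable_iff.mpr <|
    (h.locallyIntegrable.integrableOn_isCompact isCompact_uIcc).mono_set uIoc_subset_uIcc

theorem eq_add_integral (h : IsPrimitive F y) : F = fun x => F 0 + ∫ s in (0 : ℝ)..x, y s := by
  funext x
  rw [← h.sub_eq 0 x]; ring

theorem absolutelyContinuousOnInterval (h : IsPrimitive F y) (a b : ℝ) :
    AbsolutelyContinuousOnInterval F a b := by
  rw [h.eq_add_integral]
  exact (absolutelyContinuousOnInterval_const (F 0) a b).add
    (absolutelyContinuousOnInterval_integral h.intervalIntegrable 0 a b)

theorem continuous (h : IsPrimitive F y) : Continuous F := by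
  rw [h.eq_add_integral]
  exact continuous_const.add (intervalIntegral.continuous_primitive h.intervalIntegrable 0)

theorem ae_hasDerivAt (h : IsPrimitive F y) : ∀ᵐ x, HasDerivAt F (y x) x := by
  rw [h.eq_add_integral]
  filter_upwards [_root_.LocallyIntegrable.ae_hasDerivAt_integral h.locallyIntegrable] with x hx
  exact (hx 0).const_add _

theorem comp_sub (h : IsPrimitive F y) (t : ℝ) :
    IsPrimitive (fun x => F (x - t)) (fun x => y (x - t)) where
  memLp := h.memLp.comp_measurePreserving (measurePreserving_sub_const t)
  sub_eq a b := by rw [h.sub_eq, ← intervalIntegral.integral_comp_sub_right]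

theorem const_mul (h : IsPrimitive F y) (c : ℂ) :
    IsPrimitive (fun x => c * F x) (fun x => c * y x) where
  memLp := h.memLp.const_mul c
  sub_eq a b := by rw [intervalIntegral.integral_const_mul, ← h.sub_eq, mul_sub]

theorem add (h : IsPrimitive F y) (h' : IsPrimitive G z) :
    IsPrimitive (fun x => F x + G x) (fun x => y x + z x) where
  memLp := h.memLp.add h'.memLp
  sub_eq a b := by
    rw [intervalIntegral.integral_add (h.intervalIntegrable _ _) (h'.intervalIntegrable _ _),
      ← h.sub_eq, ← h'.sub_eq]
    ring

end IsPrimitive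

theorem exists_isPrimitive_of_hasGenerator {k y : L2Line}
    (h : translationGroup.HasGenerator k y) :
    ∃ K : ℝ → ℂ, K =ᵐ[volume] k ∧ IsPrimitive K (fun x => -y x) := by
  obtain ⟨K, hK, hy⟩ := exists_rep_of_hasGenerator h
  exact ⟨K, hK, (Lp.memLp y).neg, fun a b => by rw [hy, intervalIntegral.integral_neg]⟩

theorem AbsolutelyContinuousOnInterval.congr_of_eqOn {F G : ℝ → ℂ} {a b : ℝ}
    (hF : AbsolutelyContinuousOnInterval F a b) (h : EqOn F G (uIcc a b)) :
    AbsolutelyContinuousOnInterval G a b := by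
  rw [absolutelyContinuousOnInterval_iff] at hF ⊢
  intro ε hε
  obtain ⟨δ, hδ, H⟩ := hF ε hε
  refine ⟨δ, hδ, fun E hE hs => ?_⟩
  have h1 := H E hE hs
  rwa [Finset.sum_congr rfl fun i hi => by
    rw [← h (hE.1 i hi).1, ← h (hE.1 i hi).2]]

/-! ### The generator is contained in the momentum operator -/

section Graph

variable {α β : ℝ} {B : Matrix (Fin 2) (Fin 2) ℂ}

/-- The interval avoids the end points `0`, `1`, `α`, `β`, so it cannot pass between components. -/
theorem uIcc_subset_component {a b : ℝ} (h : uIcc a b ⊆ exteriorDomain α β) (hα : 1 < α)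
    (hαβ : α < β) : uIcc a b ⊆ Iio 0 ∨ uIcc a b ⊆ Ioo 1 α ∨ uIcc a b ⊆ Ioi β := by
  have hne : ∀ z, z ∉ exteriorDomain α β → z ∉ uIcc a b := fun z hz hz' => hz (h hz')
  have h0 := hne 0 (by rintro ((h | h) | h) <;> simp at h <;> linarith)
  have h1 := hne 1 (by rintro ((h | h) | h) <;> simp at h <;> linarith)
  have h2 := hne α (by rintro ((h | h) | h) <;> simp at h <;> linarith)
  have h3 := hne β (by rintro ((h | h) | h) <;> simp at h <;> linarith)
  have hmem := h left_mem_uIcc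
  wlog hab : a ≤ b generalizing a b
  · rw [uIcc_comm] at *
    exact this h hne h0 h1 h2 h3 (h left_mem_uIcc) (by linarith)
  rw [uIcc_of_le hab] at *
  simp only [mem_Icc, not_and_or, not_le] at h0 h1 h2 h3
  rcases hmem with (ha | ha) | ha
  · refine Or.inl fun x hx => ?_
    have : b < 0 := h0.resolve_left (by simp at ha; linarith)
    exact lt_of_le_of_lt hx.2 this
  · refine Or.inr (Or.inl fun x hx => ⟨ha.1.trans_le hx.1, ?_⟩)
    have : b < α := h2.resolve_left (by linarith [ha.2])
    exact lt_of_le_of_lt hx.2 this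
  · exact Or.inr (Or.inr fun x hx => lt_of_lt_of_le ha hx.1)

theorem glue_absolutelyContinuous {u₀ u₁ u₂ y₀ y₁ y₂ : ℝ → ℂ} (hα : 1 < α) (hαβ : α < β)
    (h₀ : IsPrimitive u₀ y₀) (h₁ : IsPrimitive u₁ y₁) (h₂ : IsPrimitive u₂ y₂) {a b : ℝ}
    (hab : uIcc a b ⊆ exteriorDomain α β) :
    AbsolutelyContinuousOnInterval (glue α β u₀ u₁ u₂) a b := by
  rcases uIcc_subset_component hab hα hαβ with h | h | h
  · exact (h₀.absolutelyContinuousOnInterval a b).congr_of_eqOn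
      fun x hx => (glue_of_neg (h hx)).symm
  · exact ((h₁.comp_sub α).absolutelyContinuousOnInterval a b).congr_of_eqOn
      fun x hx => (glue_of_mem_Ioo (h hx)).symm
  · exact ((h₂.comp_sub β).absolutelyContinuousOnInterval a b).congr_of_eqOn
      fun x hx => (glue_of_gt hα hαβ (h hx)).symm

theorem glue_ae_hasDerivAt {u₀ u₁ u₂ y₀ y₁ y₂ : ℝ → ℂ} (hα : 1 < α) (hαβ : α < β)
    (h₀ : IsPrimitive u₀ y₀) (h₁ : IsPrimitive u₁ y₁) (h₂ : IsPrimitive u₂ y₂) :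
    ∀ᵐ x, x ∈ exteriorDomain α β →
      HasDerivAt (glue α β u₀ u₁ u₂) (glue α β y₀ y₁ y₂ x) x := by
  filter_upwards [h₀.ae_hasDerivAt, (h₁.comp_sub α).ae_hasDerivAt, (h₂.comp_sub β).ae_hasDerivAt]
    with x d0 d1 d2 hx
  rcases hx with (hx | hx) | hx
  · rw [glue_of_neg hx]
    refine d0.congr_of_eventuallyEq ?_
    filter_upwards [isOpen_Iio.mem_nhds hx] with z hz using glue_of_neg hz
  · rw [glue_of_mem_Ioo hx]
    refine d1.congr_of_eventuallyEq ?_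
    filter_upwards [isOpen_Ioo.mem_nhds hx] with z hz using glue_of_mem_Ioo hz
  · rw [glue_of_gt hα hαβ hx]
    refine d2.congr_of_eventuallyEq ?_
    filter_upwards [isOpen_Ioi.mem_nhds hx] with z hz using glue_of_gt hα hαβ hz

theorem hasBoundaryValues_glue {u₀ u₁ u₂ : ℝ → ℂ} (hα : 1 < α) (hαβ : α < β)
    (h₀ : Continuous u₀) (h₁ : Continuous u₁) (h₂ : Continuous u₂) :
    HasBoundaryValues α β (glue α β u₀ u₁ u₂) ![u₁ (1 - α), u₂ 0] ![u₀ 0, u₁ 0] where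
  at_one := by
    have h : Tendsto (fun x => u₁ (x - α)) (𝓝[>] 1) (𝓝 (u₁ (1 - α))) :=
      ((h₁.comp (continuous_sub_right α)).tendsto 1).mono_left nhdsWithin_le_nhds
    refine h.congr' ?_
    filter_upwards [Ioo_mem_nhdsGT hα] with x hx using (glue_of_mem_Ioo hx).symm
  at_beta := by
    have h : Tendsto (fun x => u₂ (x - β)) (𝓝[>] β) (𝓝 (u₂ (β - β))) :=
      ((h₂.comp (continuous_sub_right β)).tendsto β).mono_left nhdsWithin_le_nhds
    rw [sub_self] at h
    refine h.congr' ?_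
    filter_upwards [self_mem_nhdsWithin] with x hx using (glue_of_gt hα hαβ hx).symm
  at_zero := by
    refine ((h₀.tendsto 0).mono_left nhdsWithin_le_nhds).congr' ?_
    filter_upwards [self_mem_nhdsWithin] with x hx using (glue_of_neg hx).symm
  at_alpha := by
    have h : Tendsto (fun x => u₁ (x - α)) (𝓝[<] α) (𝓝 (u₁ (α - α))) :=
      ((h₁.comp (continuous_sub_right α)).tendsto α).mono_left nhdsWithin_le_nhds
    rw [sub_self] at h
    refine h.congr' ?_
    filter_upwards [Ioo_mem_nhdsLT hα] with x hx using (glue_of_mem_Ioo hx).symm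

/-- The unitary group on the exterior domain, as the transport of the translation group. -/
noncomputable def exteriorGroup (hα : 1 < α) (hαβ : α < β)
    (hB : B ∈ Matrix.unitaryGroup (Fin 2) ℂ) (hq : ‖B 1 0‖ < 1) :
    UnitaryOneParameterGroup (L2Exterior α β) :=
  translationGroup.conj (exteriorEquiv hα hαβ hB hq)

/-- The wave operators commute with translations, hence preserve the domain of the translation
generator. Thus all three waves have absolutely continuous representatives, which glue to one of
`f`. -/
theorem mem_momentumGraph_of_hasGenerator (hα : 1 < α) (hαβ : α < β)
    (hB : B ∈ Matrix.unitaryGroup (Fin 2) ℂ) (hq : ‖B 1 0‖ < 1) {f h : L2Exterior α β}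
    (hf : (exteriorGroup hα hαβ hB hq).HasGenerator f (-(2 * Real.pi * Complex.I : ℂ) • h)) :
    (f, h) ∈ momentumGraph α β B := by
  have hgen := UnitaryOneParameterGroup.HasGenerator.of_conj hf
  set k := (exteriorEquiv hα hαβ hB hq).symm f with hk
  set y := (exteriorEquiv hα hαβ hB hq).symm (-(2 * Real.pi * Complex.I : ℂ) • h) with hy
  have hf_ae : f =ᵐ[volume.restrict (exteriorDomain α β)] exteriorFun α β B k := by
    have h1 := coeFn_exteriorIsometry hα hαβ hB hq k
    have h2 : exteriorIsometry hα hαβ hB hq k = f :=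
      (exteriorEquiv hα hαβ hB hq).apply_symm_apply f
    rwa [h2] at h1
  have hh_ae : ∀ᵐ x ∂volume.restrict (exteriorDomain α β),
      -(2 * Real.pi * Complex.I : ℂ) * h x = exteriorFun α β B y x := by
    have h1 := coeFn_exteriorIsometry hα hαβ hB hq y
    have h2 : exteriorIsometry hα hαβ hB hq y = -(2 * Real.pi * Complex.I : ℂ) • h :=
      (exteriorEquiv hα hαβ hB hq).apply_symm_apply _
    rw [h2] at h1
    filter_upwards [h1, Lp.coeFn_smul (-(2 * Real.pi * Complex.I : ℂ)) h] with x h3 h4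
    rw [← h3, h4, Pi.smul_apply, smul_eq_mul]
  set L := α - 1 with hL
  obtain ⟨K, hKk, hK⟩ := exists_isPrimitive_of_hasGenerator hgen
  obtain ⟨Q, hQm, hQ⟩ := exists_isPrimitive_of_hasGenerator
    (hgen.map (interiorWave B L) fun t x => interiorWave_comm hq L t x)
  have hN := ((hQ.comp_sub L).const_mul (B 0 0)).add (hK.const_mul (B 0 1))
  set N : ℝ → ℂ := fun x => B 0 0 * Q (x - L) + B 0 1 * K x with hN_def
  -- Both sides are continuous, so the almost everywhere recursion holds everywhere; at `x = 0` it
  -- is the boundary condition at `α`. The condition at `0` is built into `N`.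
  have hQeq : ∀ x, Q x = B 1 0 * Q (x - L) + B 1 1 * K x := by
    have hc := ((hQ.comp_sub L).const_mul (B 1 0)).add (hK.const_mul (B 1 1))
    refine congrFun (Continuous.ae_eq_iff_eq volume hQ.continuous hc.continuous |>.1 ?_)
    filter_upwards [hQm, hKk, ae_comp_sub hQm L, coeFn_interiorWave hq L k] with x h1 h2 h3 h4
    rw [h1, h2, h3, h4]
  have hNn : N =ᵐ[volume] incomingWave B L k := by
    filter_upwards [hKk, ae_comp_sub hQm L, coeFn_incomingWave (B := B) L k] with x h2 h3 h4
    rw [h4, hN_def]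
    simp only [h2, h3]
  refine ⟨glue α β N Q K, ⟨?_, ?_, ?_⟩, _, _,
    hasBoundaryValues_glue hα hαβ hN.continuous hQ.continuous hK.continuous, ?_⟩
  · filter_upwards [ae_restrict_of_ae (glue_ae_congr hNn hQm hKk), hf_ae] with x h1 h2
    rw [h1, h2, exteriorFun]
  · exact fun a b hab => glue_absolutelyContinuous hα hαβ hN hQ hK hab
  · have hd := ae_exteriorDomain_iff.2 (glue_ae_hasDerivAt hα hαβ hN hQ hK)
    have hc : glue α β (fun x => B 0 0 * -interiorWave B L y (x - L) + B 0 1 * -y x)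
        (fun x => -interiorWave B L y x) (fun x => -y x) =ᵐ[volume]
        fun x => -exteriorFun α β B y x := by
      have h1 : (fun x => B 0 0 * -interiorWave B L y (x - L) + B 0 1 * -y x) =ᵐ[volume]
          fun x => -incomingWave B L y x := by
        filter_upwards [coeFn_incomingWave (B := B) L y] with x hx
        rw [hx]; ring
      refine (glue_ae_congr h1 (ae_eq_refl _) (ae_eq_refl _)).trans
        (Eventually.of_forall fun x => ?_)
      simp only [exteriorFun, glue]
      split_ifs <;> rfl
    filter_upwards [hd, hh_ae, ae_restrict_of_ae hc] with x h1 h2 h3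
    rw [h3, ← h2] at h1
    convert h1 using 1
    ring
  · ext i
    have e : 1 - α = 0 - L := by rw [hL]; ring
    fin_cases i
    · simp [Matrix.mulVec, dotProduct, Fin.sum_univ_two, hN_def, e]
    · simp [Matrix.mulVec, dotProduct, Fin.sum_univ_two, hQeq 0, e]

end Graph

/-! ### The momentum operator generates the group -/

section Injective

variable {α β : ℝ} {B : Matrix (Fin 2) (Fin 2) ℂ}

/-- Absolutely continuous solutions of `F' = F` are multiples of the exponential function. -/
theorem exists_eq_mul_exp {F : ℝ → ℂ} {s Ω : Set ℝ} (hs : s.OrdConnected) (hne : s.Nonempty)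
    (hsΩ : s ⊆ Ω) (hac : ∀ a b, uIcc a b ⊆ Ω → AbsolutelyContinuousOnInterval F a b)
    (hd : ∀ᵐ x, x ∈ Ω → HasDerivAt F (F x) x) :
    ∃ C : ℂ, ∀ x ∈ s, F x = C * Complex.exp x := by
  obtain ⟨c, hc⟩ := hne
  refine ⟨Complex.exp (-c) * F c, fun x hx => ?_⟩
  have hsub : uIcc c x ⊆ Ω := (hs.uIcc_subset hc hx).trans hsΩ
  have hexp : AbsolutelyContinuousOnInterval (fun x : ℝ => Complex.exp (-x)) c x := by
    refine ContDiffOn.absolutelyContinuousOnInterval (ContDiff.contDiffOn ?_)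
    exact (Complex.ofRealCLM.contDiff.neg).cexp
  -- The product `exp(-x) F(x)` is absolutely continuous with derivative zero almost everywhere,
  -- hence constant.
  obtain ⟨C, hC⟩ := (hexp.smul (hac c x hsub)).const_of_ae_hasDerivAt_zero (by
    filter_upwards [hd] with z hz hzs
    have h1 : HasDerivAt (fun x : ℝ => Complex.exp (-x)) (-Complex.exp (-z)) z := by
      have := ((Complex.ofRealCLM.hasDerivAt (x := z)).neg).cexp
      simpa using this
    have h2 := h1.smul (hz (hsub hzs))
    convert h2 using 1
    simp)
  have h1 := (hC x right_mem_uIcc).trans (hC c left_mem_uIcc).symm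
  simp only [Pi.smul_apply', smul_eq_mul] at h1
  rw [← h1, mul_right_comm, ← Complex.exp_add, neg_add_cancel, Complex.exp_zero, one_mul]

/-- On `(b, ∞)` the function is bounded below by `‖C‖ exp b`, and a nonzero constant is not
integrable there. -/
theorem eq_zero_of_memLp_mul_exp {F : ℝ → ℂ} {C : ℂ} {b : ℝ}
    (hF : MemLp F 2 (volume.restrict (Ioi b))) (h : ∀ x ∈ Ioi b, F x = C * Complex.exp x) :
    C = 0 := by
  by_contra hC
  have hi : IntegrableOn (fun x => ‖F x‖ ^ 2) (Ioi b) := hF.integrable_norm_pow (by norm_num)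
  have hc : IntegrableOn (fun _ : ℝ => (‖C‖ * Real.exp b) ^ 2) (Ioi b) := by
    refine Integrable.mono' hi aestronglyMeasurable_const ?_
    refine (ae_restrict_iff' measurableSet_Ioi).2 (Eventually.of_forall fun x hx => ?_)
    rw [h x hx, norm_mul, Complex.norm_exp, Complex.ofReal_re, Real.norm_of_nonneg (by positivity)]
    have : Real.exp b ≤ Real.exp x := Real.exp_le_exp.2 (le_of_lt hx)
    gcongr
  rw [integrableOn_const_iff] at hc
  rcases hc with hc | hc
  · have h1 := Real.exp_pos b
    have h2 := norm_pos_iff.2 hC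
    have : 0 < (‖C‖ * Real.exp b) ^ 2 := by positivity
    exact this.ne' (enorm_eq_zero.1 hc)
  · simp at hc

/-- The hypothesis says `f' = f`, so `f` is a multiple of the exponential on each component. Square
integrability kills the multiple on `(β, ∞)`. The condition at `α` becomes `C₁ exp α = B₁₀ C₁ exp
1`, impossible for `C₁ ≠ 0` as `|B₁₀| < 1` and `α > 1`; the condition at `0` then gives `C₀ = 0`. -/
theorem eq_zero_of_mem_momentumGraph (hα : 1 < α) (hq : ‖B 1 0‖ < 1) {f h : L2Exterior α β}
    (hfh : (f, h) ∈ momentumGraph α β B) (hfix : (2 * Real.pi * Complex.I : ℂ) • h = f) :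
    f = 0 := by
  obtain ⟨F, ⟨hae, hac, hd⟩, ρ₁, ρ₂, hρ, hBρ⟩ := hfh
  simp only at hae hd
  have hd' : ∀ᵐ x, x ∈ exteriorDomain α β → HasDerivAt F (F x) x := by
    refine ae_exteriorDomain_iff.1 ?_
    filter_upwards [hae, hd, Lp.coeFn_smul (2 * Real.pi * Complex.I : ℂ) h] with x h1 h2 h3
    rw [hfix] at h3
    rw [h1, h3]
    exact h2
  obtain ⟨C₀, h₀⟩ := exists_eq_mul_exp ordConnected_Iio nonempty_Iio
    (Iio_subset_exteriorDomain α β) hac hd'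
  obtain ⟨C₁, h₁⟩ := exists_eq_mul_exp ordConnected_Ioo (nonempty_Ioo.2 hα)
    (Ioo_subset_exteriorDomain α β) hac hd'
  obtain ⟨C₂, h₂⟩ := exists_eq_mul_exp ordConnected_Ioi nonempty_Ioi
    (Ioi_subset_exteriorDomain α β) hac hd'
  have hmem : MemLp F 2 (volume.restrict (exteriorDomain α β)) :=
    (memLp_congr_ae hae).2 (Lp.memLp f)
  have hC₂ : C₂ = 0 := eq_zero_of_memLp_mul_exp
    (hmem.mono_measure (Measure.restrict_mono_set _ (Ioi_subset_exteriorDomain α β))) h₂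
  have hlim : ∀ (C : ℂ) (p : ℝ) (l : Filter ℝ), l ≤ 𝓝 p →
      Tendsto (fun x : ℝ => C * Complex.exp x) l (𝓝 (C * Complex.exp p)) := fun C p l hl =>
    ((by fun_prop : Continuous fun x : ℝ => C * Complex.exp x).tendsto p).mono_left hl
  have e10 : ρ₁ 0 = C₁ * Complex.exp (1 : ℝ) := by
    refine tendsto_nhds_unique hρ.at_one ((hlim C₁ 1 _ nhdsWithin_le_nhds).congr' ?_)
    filter_upwards [Ioo_mem_nhdsGT hα] with x hx using (h₁ x hx).symm
  have e21 : ρ₂ 1 = C₁ * Complex.exp α := by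
    refine tendsto_nhds_unique hρ.at_alpha ((hlim C₁ α _ nhdsWithin_le_nhds).congr' ?_)
    filter_upwards [Ioo_mem_nhdsLT hα] with x hx using (h₁ x hx).symm
  have e11 : ρ₁ 1 = C₂ * Complex.exp β := by
    refine tendsto_nhds_unique hρ.at_beta ((hlim C₂ β _ nhdsWithin_le_nhds).congr' ?_)
    filter_upwards [self_mem_nhdsWithin] with x hx using (h₂ x hx).symm
  have e20 : ρ₂ 0 = C₀ * Complex.exp (0 : ℝ) := by
    refine tendsto_nhds_unique hρ.at_zero ((hlim C₀ 0 _ nhdsWithin_le_nhds).congr' ?_)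
    filter_upwards [self_mem_nhdsWithin] with x hx using (h₀ x hx).symm
  have b0 := congrFun hBρ 0
  have b1 := congrFun hBρ 1
  simp only [Matrix.mulVec, dotProduct, Fin.sum_univ_two, e10, e11, e20, e21, hC₂, zero_mul,
    mul_zero, add_zero] at b0 b1
  have hC₁ : C₁ = 0 := by
    by_contra hC
    have hn := congrArg norm b1
    rw [norm_mul, norm_mul, norm_mul, Complex.norm_exp, Complex.norm_exp, Complex.ofReal_re,
      Complex.ofReal_re] at hn
    have h1 : 0 < ‖C₁‖ * Real.exp 1 := mul_pos (norm_pos_iff.2 hC) (Real.exp_pos _)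
    have h2 : Real.exp 1 ≤ Real.exp α := Real.exp_le_exp.2 hα.le
    have h3 : ‖C₁‖ * Real.exp 1 ≤ ‖C₁‖ * Real.exp α := by gcongr
    nlinarith
  have hC₀ : C₀ = 0 := by
    rw [hC₁] at b0
    simpa using b0.symm
  rw [Lp.eq_zero_iff_ae_eq_zero]
  filter_upwards [hae, ae_restrict_mem (isOpen_exteriorDomain α β).measurableSet] with x hx hxm
  rw [← hx]
  rcases hxm with (hxm | hxm) | hxm
  · rw [h₀ x hxm, hC₀, zero_mul]; rfl
  · rw [h₁ x hxm, hC₁, zero_mul]; rfl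
  · rw [h₂ x hxm, hC₂, zero_mul]; rfl

theorem exteriorGroup_isGeneratedBy (hα : 1 < α) (hαβ : α < β)
    (hB : B ∈ Matrix.unitaryGroup (Fin 2) ℂ) (hq : ‖B 1 0‖ < 1) :
    (exteriorGroup hα hαβ hB hq).IsGeneratedBy (momentumOperator α β B) := by
  refine UnitaryOneParameterGroup.isGeneratedBy_of_injective _ _ (fun f h hf => ?_)
    fun f h hfh hfix => ?_
  · rw [momentumOperator_graph]
    exact mem_momentumGraph_of_hasGenerator hα hαβ hB hq hf
  · rw [momentumOperator_graph] at hfh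
    exact eq_zero_of_mem_momentumGraph hα hq hfh hfix

theorem tendsto_inner_exteriorGroup (hα : 1 < α) (hαβ : α < β)
    (hB : B ∈ Matrix.unitaryGroup (Fin 2) ℂ) (hq : ‖B 1 0‖ < 1) (f g : L2Exterior α β) :
    Tendsto (fun t : ℝ => inner ℂ f ((exteriorGroup hα hαβ hB hq).toFun t g)) atTop (𝓝 0) := by
  set W := exteriorEquiv hα hαβ hB hq with hW
  refine (tendsto_inner_lineTranslation (W.symm f) (W.symm g)).congr fun t => ?_
  change _ = inner ℂ f (W (lineTranslation t (W.symm g)))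
  rw [← W.inner_map_map, W.apply_symm_apply]

end Injective

/-! ### Uniqueness of the group and mean-square decay. -/

namespace UnitaryOneParameterGroup

variable {H : Type*} [NormedAddCommGroup H] [InnerProductSpace ℂ H]

theorem eq_of_isGeneratedBy [CompleteSpace H] {U V : UnitaryOneParameterGroup H}
    {A : H →ₗ.[ℂ] H} (hU : U.IsGeneratedBy A) (hV : V.IsGeneratedBy A) : U = V := by
  rw [isGeneratedBy_iff] at hU hV
  refine ext_of_hasGenerator fun x y => ?_
  have hc : (-(2 * Real.pi * Complex.I) : ℂ) ≠ 0 := neg_ne_zero.2 Complex.two_pi_I_ne_zero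
  have h := (hU x ((-(2 * Real.pi * Complex.I) : ℂ)⁻¹ • y)).symm.trans (hV x _)
  rwa [smul_inv_smul₀ hc] at h

theorem inner_toFun_neg (U : UnitaryOneParameterGroup H) (f g : H) (t : ℝ) :
    inner ℂ f (U.toFun (-t) g) = inner ℂ (U.toFun t f) g := by
  rw [← (U.toFun t).inner_map_map f, ← U.map_add, add_neg_cancel, U.map_zero]

/-- Decay of the matrix coefficients implies that their mean square tends to zero. -/
theorem tendsto_mean_sq_inner (U : UnitaryOneParameterGroup H)
    (h : ∀ f g : H, Tendsto (fun t : ℝ => inner ℂ f (U.toFun t g)) atTop (𝓝 0)) (f g : H) :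
    Tendsto (fun T : ℝ => 1 / (2 * T) * ∫ t in (-T)..T, ‖inner ℂ f (U.toFun t g)‖ ^ 2)
      atTop (𝓝 0) := by
  set φ : ℝ → ℝ := fun t => ‖inner ℂ f (U.toFun t g)‖ ^ 2 with hφ
  have hcont : Continuous φ := ((continuous_const.inner (U.continuous g)).norm.pow 2)
  have htop : Tendsto φ atTop (𝓝 0) := by
    simpa using ((h f g).norm.pow 2)
  -- Since `U(-t)` is the adjoint of `U(t)`, decay at `-∞` is decay at `+∞` with `f` and `g`
  -- exchanged.
  have hbot : Tendsto φ atBot (𝓝 0) := by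
    have h1 : Tendsto (fun t : ℝ => ‖inner ℂ g (U.toFun t f)‖ ^ 2) atTop (𝓝 0) := by
      simpa using ((h g f).norm.pow 2)
    refine (h1.comp tendsto_neg_atBot_atTop).congr fun t => ?_
    simp only [Function.comp, hφ]
    rw [inner_toFun_neg, ← norm_inner_symm]
  have hbound : ∀ t, φ t ≤ (‖f‖ * ‖g‖) ^ 2 := by
    intro t
    have := norm_inner_le_norm (𝕜 := ℂ) f (U.toFun t g)
    rw [LinearIsometryEquiv.norm_map] at this
    simp only [hφ]
    gcongr
  -- Substituting `t = T s` turns the mean into half an integral over `[-1, 1]`, whose bounded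
  -- integrand tends to zero for every `s ≠ 0`.
  have hlim : Tendsto (fun T : ℝ => ∫ s in (-1 : ℝ)..1, φ (T * s)) atTop
      (𝓝 (∫ _ in (-1 : ℝ)..1, (0 : ℝ))) := by
    refine intervalIntegral.tendsto_integral_filter_of_dominated_convergence
      (fun _ => (‖f‖ * ‖g‖) ^ 2) ?_ ?_ ?_ ?_
    · exact Eventually.of_forall fun T =>
        (hcont.comp (continuous_const.mul continuous_id)).aestronglyMeasurable
    · refine Eventually.of_forall fun T => Eventually.of_forall fun s _ => ?_
      rw [Real.norm_of_nonneg (by simp only [hφ]; positivity)]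
      exact hbound _
    · exact intervalIntegrable_const
    · have hne : ∀ᵐ s : ℝ, s ≠ 0 := by simp [ae_iff, measure_singleton]
      filter_upwards [hne] with s hs _
      rcases lt_or_gt_of_ne hs with hs | hs
      · exact hbot.comp (tendsto_id.atTop_mul_const_of_neg hs)
      · exact htop.comp (tendsto_id.atTop_mul_const hs)
  rw [intervalIntegral.integral_zero] at hlim
  have h2 := hlim.const_mul (1 / 2)
  rw [mul_zero] at h2
  refine h2.congr' ?_
  filter_upwards [eventually_gt_atTop 0] with T hT
  rw [intervalIntegral.integral_comp_mul_left _ hT.ne', mul_neg, mul_one, smul_eq_mul]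
  field_simp

end UnitaryOneParameterGroup

/-! ### The boundary matrix -/

theorem unitExp_add (x y : ℝ) : unitExp (x + y) = unitExp x * unitExp y := by
  rw [unitExp, unitExp, unitExp, ← Complex.exp_add]
  push_cast
  ring_nf

theorem unitExp_zero : unitExp 0 = 1 := by simp [unitExp]

theorem norm_unitExp (x : ℝ) : ‖unitExp x‖ = 1 := by
  rw [unitExp, show (2 * Real.pi * Complex.I * x : ℂ) = ((2 * Real.pi * x : ℝ) : ℂ) * Complex.I by
    push_cast; ring, Complex.norm_exp_ofReal_mul_I]

theorem conj_unitExp (x : ℝ) : starRingEnd ℂ (unitExp x) = unitExp (-x) := by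
  rw [unitExp, unitExp, ← Complex.exp_conj]
  simp [Complex.conj_ofNat]

theorem boundaryMatrix_mem_unitaryGroup (w θ φ ψ : ℝ) (hw₀ : 0 < w) (hw₁ : w ≤ 1) :
    boundaryMatrix w θ φ ψ ∈ Matrix.unitaryGroup (Fin 2) ℂ := by
  have hs : ((Real.sqrt (1 - w ^ 2) : ℝ) : ℂ) ^ 2 = 1 - (w : ℂ) ^ 2 := by
    rw [← Complex.ofReal_pow, Real.sq_sqrt (by nlinarith)]
    push_cast; ring
  have hinv : ∀ x, unitExp x * unitExp (-x) = 1 := fun x => by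
    rw [← unitExp_add, add_neg_cancel, unitExp_zero]
  have hθφ : unitExp (θ - φ) = unitExp θ * unitExp (-φ) := by
    rw [← unitExp_add, sub_eq_add_neg]
  have hθψ : unitExp (θ - ψ) = unitExp θ * unitExp (-ψ) := by
    rw [← unitExp_add, sub_eq_add_neg]
  have iθ := hinv θ
  have iφ := hinv φ
  have iψ := hinv ψ
  rw [Matrix.mem_unitaryGroup_iff]
  ext i j
  fin_cases i <;> fin_cases j <;>
    simp [boundaryMatrix, Matrix.mul_apply, Fin.sum_univ_two, conj_unitExp, hθφ, hθψ]
  · linear_combination (w : ℂ) ^ 2 * iφ + (Real.sqrt (1 - w ^ 2) : ℂ) ^ 2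
      * (unitExp ψ * unitExp (-ψ) * iθ + iψ) + hs
  · linear_combination -(w * Real.sqrt (1 - w ^ 2) * unitExp φ * unitExp (-ψ)) * iθ
  · linear_combination -(w * Real.sqrt (1 - w ^ 2) * unitExp ψ * unitExp (-φ)) * iθ
  · linear_combination (Real.sqrt (1 - w ^ 2) : ℂ) ^ 2 * iψ + (w : ℂ) ^ 2
      * (unitExp φ * unitExp (-φ) * iθ + iφ) + hs

/-- Strict positivity of `w` is essential here: at `w = 0` this entry would have modulus one and a
wave in `(1, α)` would stay trapped. -/
theorem norm_boundaryMatrix_one_zero_lt (w θ φ ψ : ℝ) (hw₀ : 0 < w) :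
    ‖boundaryMatrix w θ φ ψ 1 0‖ < 1 := by
  have h : boundaryMatrix w θ φ ψ 1 0 = Real.sqrt (1 - w ^ 2) * unitExp ψ := rfl
  rw [h, norm_mul, norm_unitExp, mul_one, Complex.norm_real,
    Real.norm_of_nonneg (Real.sqrt_nonneg _), Real.sqrt_lt' one_pos]
  nlinarith

theorem corollary3p34 (α β : ℝ) (hα : 1 < α) (hαβ : α < β)
    (w θ φ ψ : ℝ) (hw₀ : 0 < w) (hw₁ : w ≤ 1) :
    (∃! U : UnitaryOneParameterGroup (L2Exterior α β),
      U.IsGeneratedBy (momentumOperator α β (boundaryMatrix w θ φ ψ))) ∧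
    ∀ U : UnitaryOneParameterGroup (L2Exterior α β),
      U.IsGeneratedBy (momentumOperator α β (boundaryMatrix w θ φ ψ)) →
      ∀ f g : L2Exterior α β,
        Tendsto (fun t : ℝ => inner ℂ f (U.toFun t g)) atTop (𝓝 0) ∧
        Tendsto (fun T : ℝ => 1 / (2 * T) * ∫ t in (-T)..T, ‖inner ℂ f (U.toFun t g)‖ ^ 2)
          atTop (𝓝 0) := by
  have hB := boundaryMatrix_mem_unitaryGroup w θ φ ψ hw₀ hw₁
  have hq := norm_boundaryMatrix_one_zero_lt w θ φ ψ hw₀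
  have hgen := exteriorGroup_isGeneratedBy hα hαβ hB hq
  refine ⟨⟨_, hgen, fun U hU => UnitaryOneParameterGroup.eq_of_isGeneratedBy hU hgen⟩,
    fun U hU f g => ?_⟩
  rw [UnitaryOneParameterGroup.eq_of_isGeneratedBy hU hgen]
  have hdecay := tendsto_inner_exteriorGroup hα hαβ hB hq
  exact ⟨hdecay f g, UnitaryOneParameterGroup.tendsto_mean_sq_inner _ hdecay f g⟩
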